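/- Let $n\ge 2$. Let $e_{ij}$ ($0\le i,j\le n$) be the matrix units of $\mathfrak{gl}_{n+1}(\mathbb C)$, let $h_i=e_{ii}-\frac1{n+1}\sum_{k=0}^n e_{kk}$, and let $\mathfrak h_n$ be the Cartan subalgebra of $\mathfrak{sl}_{n+1}$ with basis $h_1,\dots,h_n$. Let $U_S$ be the localization of $U(\mathfrak{sl}_{n+1})$ at the Ore set $S=\{e_{01}^{i_1}\cdots e_{0n}^{i_n}\mid i_1,\dots,i_n\in\mathbb Z_{\ge0}\}$, let $B\subset U_S$ be the subalgebra generated by all $h_i,e_{0k},e_{0k}^{-1}$ ($1\le i,k\le n$), and let $W$ be the centralizer of $B$ in $U_S$. The algebra $W$ is generated by the elements $$x_{ij}=e_{ij}e_{0i}e_{0j}^{-1}-h_i\ (1\le i\ne j\le n),\qquad \omega_k=e_{k0}e_{0k}+\sum_{j=1}^n\Big(e_{kj}-\tfrac{\delta_{jk}}{n+1}\sum_{l=0}^n e_{ll}\Big)(h_j-1)e_{0k}e_{0j}^{-1}\ (1\le k\le n),$$ and there is an algebra homomorphism $\tau:W\to U(\mathfrak{gl}_n)$ such that $\tau(x_{ij})=e_{ij}-e_{ii}$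 and $\tau(\omega_k)=\sum_{j=1}^n(e_{kj}e_{jj}-e_{kj})$. For a $\mathfrak{gl}_n$-module $V$ let $V^\tau$ be the $W$-module $V$ on which $w\in W$ acts as $\tau(w)$. For $\mu\in\mathbb C^n$ and a finite-dimensional $W$-module $N$, let each $h_i$ ($1\le i\le n$) act on $N$ as the scalar $\mu_i$, and let $G_\mu(N)=U_S\otimes_{U(\mathfrak h_n)W}N$, regarded as an $\mathfrak{sl}_{n+1}$-module. An $\mathfrak{sl}_{n+1}$-module $M$ is called cuspidal if $M=\bigoplus_{\alpha\in\mathbb C^n}M_\alpha$, where $M_\alpha=\{v\in M\mid h_iv=\alpha_iv,\ 1\le i\le n\}$, all the spaces $M_\alpha$ are finite-dimensional, and every $e_{ij}$ ($0\le i\ne j\le n$) acts injectively on $M$. **Lemma.** Let $V(\lambda)$ be a finite-dimensional irreducible $\mathfrak{gl}_n$-module with highest weight $\lambda=(\lambda_1,\dots,\lambda_n)\in\mathbb C^n$ (that is, $V(\lambda)$ contains a nonzero vector $v$ with $e_{ij}v=0$ for $i<j$ and $e_{ii}v=\lambda_iv$ for all $i$), let $\mu\in\mathbb C^n$, and put $|\mu|=\mu_1+\dots+\mu_n$.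 Then the $\mathfrak{sl}_{n+1}$-module $G_\mu(V(\lambda)^\tau)$ is cuspidal if and only if $$\mu_i-\lambda_i\notin\mathbb Z\quad\text{and}\quad|\mu|+\lambda_i\notin\mathbb Z\qquad\text{for every } i\in\{1,\dots,n\}.$$ -/

import Mathlib

attribute [local instance 100] LieRing.ofAssociativeRing
open scoped TensorProduct
namespace CuspidalGL

noncomputable section

/-- The general linear Lie algebra `gl_n` over `ℂ`. The index `i : Fin n` stands for `i + 1` in the
numbering `1, …, n`. -/
abbrev gl (n : ℕ) : Type := Matrix (Fin n) (Fin n) ℂ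
/-- The special linear Lie algebra `sl_{n+1}`: traceless matrices with rows and columns numbered
`0, …, n`. The copy of `{1, …, n}` inside `{0, …, n}` is the image of `Fin.succ : Fin n → Fin (n + 1)`. -/
abbrev sl (n : ℕ) : LieSubalgebra ℂ (Matrix (Fin (n + 1)) (Fin (n + 1)) ℂ) :=
  LieAlgebra.SpecialLinear.sl (Fin (n + 1)) ℂ
/-- The enveloping algebra `U(sl_{n+1})`. -/
abbrev USl (n : ℕ) : Type := UniversalEnvelopingAlgebra ℂ (sl n)
/-- The enveloping algebra `U(gl_n)`. -/
abbrev UGl (n : ℕ) : Type := UniversalEnvelopingAlgebra ℂ (gl n)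

/-- The root vector `e_{ij}` of `sl_{n+1}`, `0 ≤ i ≠ j ≤ n`. -/
def rootVec {n : ℕ} (i j : Fin (n + 1)) (h : i ≠ j) : sl n :=
  LieAlgebra.SpecialLinear.single i j h (1 : ℂ)

/-- The element `h_i = e_{ii} - (1 / (n + 1)) I_{n+1}` of the Cartan subalgebra of `sl_{n+1}`. -/
def hElt {n : ℕ} (i : Fin (n + 1)) : sl n :=
  ⟨Matrix.single i i (1 : ℂ) -
      (1 / ((n : ℂ) + 1)) • (1 : Matrix (Fin (n + 1)) (Fin (n + 1)) ℂ), by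
    have : ((n : ℂ) + 1) ≠ 0 := by exact_mod_cast Nat.succ_ne_zero n
    change Matrix.trace (_ : Matrix (Fin (n + 1)) (Fin (n + 1)) ℂ) = 0
    simp [Matrix.trace_sub, Matrix.trace_smul, this]⟩

/-- The element `e_{0k}` of `U(sl_{n+1})`, `1 ≤ k ≤ n`. -/
def e0 {n : ℕ} (k : Fin n) : USl n :=
  UniversalEnvelopingAlgebra.ι ℂ (rootVec 0 k.succ (Fin.succ_ne_zero k).symm)

/-- The multiplicative set `S` of all monomials in the commuting elements `e_{01}, …, e_{0n}`. -/
def oreS (n : ℕ) : Submonoid (USl n) := Submonoid.closure (Set.range e0)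

theorem e0_mem {n : ℕ} (k : Fin n) : e0 k ∈ oreS n := Submonoid.subset_closure ⟨k, rfl⟩

section Ore
variable {R : Type*} [Ring R] [Algebra ℂ R]

theorem ad_pow_mul (s a b : R) (N M : ℕ) (ha : (LieAlgebra.ad ℂ R s ^ N) a = 0)
    (hb : (LieAlgebra.ad ℂ R s ^ M) b = 0) : (LieAlgebra.ad ℂ R s ^ (N + M)) (a * b) = 0 := by
  induction hk : N + M generalizing N M a b with
  | zero =>
    obtain ⟨rfl, rfl⟩ : N = 0 ∧ M = 0 := by omega
    have : a = 0 := by simpa using ha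
    simp [this]
  | succ k ih =>
    rcases N with _ | N
    · have : a = 0 := by simpa using ha
      simp [this]
    rcases M with _ | M
    · have : b = 0 := by simpa using hb
      simp [this]
    have h : (LieAlgebra.ad ℂ R s) (a * b) =
        (LieAlgebra.ad ℂ R s) a * b + a * (LieAlgebra.ad ℂ R s) b := by
      simp only [LieAlgebra.ad_apply, Ring.lie_def]; noncomm_ring
    have ha' := ha
    have hb' := hb
    rw [pow_succ, Module.End.mul_apply] at ha' hb'
    rw [pow_succ, Module.End.mul_apply, h, map_add,
      ih _ b N (M + 1) ha' hb (by omega), ih a _ (N + 1) M ha hb' (by omega), add_zero]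

/-- The elements on which `ad s` acts nilpotently -/
def adNil (s : R) : Subalgebra ℂ R where
  carrier := {r | ∃ N : ℕ, (LieAlgebra.ad ℂ R s ^ N) r = 0}
  mul_mem' := by
    rintro a b ⟨N, hN⟩ ⟨M, hM⟩
    exact ⟨N + M, ad_pow_mul s a b N M hN hM⟩
  add_mem' := by
    rintro a b ⟨N, hN⟩ ⟨M, hM⟩
    refine ⟨N + M, ?_⟩
    rw [map_add, Module.End.pow_map_zero_of_le (Nat.le_add_right N M) hN,
      Module.End.pow_map_zero_of_le (Nat.le_add_left M N) hM, add_zero]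
  algebraMap_mem' c := ⟨1, by
    simp [LieAlgebra.ad_apply, Ring.lie_def, Algebra.commutes]⟩

theorem ore_num_of_ad (s r : R) (N : ℕ) (hr : (LieAlgebra.ad ℂ R s ^ N) r = 0) :
    ∃ r', s ^ N * r = r' * s := by
  induction N generalizing r with
  | zero => exact ⟨0, by simpa using hr⟩
  | succ N ih =>
    rw [pow_succ, Module.End.mul_apply, LieAlgebra.ad_apply] at hr
    obtain ⟨d, hd⟩ := ih _ hr
    refine ⟨s ^ N * r + d, ?_⟩
    rw [add_mul, ← hd, Ring.lie_def, pow_succ]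
    noncomm_ring

theorem ore_cancel_of_ad (s r : R) (N : ℕ) (hr : (LieAlgebra.ad ℂ R s ^ N) r = 0)
    (h : r * s = 0) : s ^ N * r = 0 := by
  induction N generalizing r with
  | zero => simpa using hr
  | succ N ih =>
    rw [pow_succ, Module.End.mul_apply, LieAlgebra.ad_apply] at hr
    have := ih _ hr (by rw [Ring.lie_def, sub_mul, mul_assoc, h]; simp)
    rw [Ring.lie_def, h, sub_zero] at this
    rw [pow_succ, mul_assoc, this]

end Ore

theorem ueaSubalgebra_eq_top {L : Type*} [LieRing L] [LieAlgebra ℂ L]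
    (T : Subalgebra ℂ (UniversalEnvelopingAlgebra ℂ L))
    (hT : ∀ y : L, UniversalEnvelopingAlgebra.ι ℂ y ∈ T) : T = ⊤ := by
  let g : L →ₗ⁅ℂ⁆ T :=
    { toFun := fun y => ⟨UniversalEnvelopingAlgebra.ι ℂ y, hT y⟩
      map_add' := fun a b => Subtype.ext (map_add _ a b)
      map_smul' := fun c a => Subtype.ext (map_smul _ c a)
      map_lie' := fun {a b} => Subtype.ext (LieHom.map_lie _ a b) }
  have h : T.val.comp (UniversalEnvelopingAlgebra.lift ℂ g) = AlgHom.id ℂ _ := by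
    apply UniversalEnvelopingAlgebra.hom_ext
    ext y
    change ((UniversalEnvelopingAlgebra.lift ℂ g) (UniversalEnvelopingAlgebra.ι ℂ y) : T).1 = _
    rw [UniversalEnvelopingAlgebra.lift_ι_apply]
    rfl
  refine eq_top_iff.2 fun r _ => ?_
  have := DFunLike.congr_fun h r
  exact (show (UniversalEnvelopingAlgebra.lift ℂ g r : T).1 = r from this) ▸
    (UniversalEnvelopingAlgebra.lift ℂ g r).2

theorem rootVec_lie3 {n : ℕ} (i j : Fin (n + 1)) (h : i ≠ j) (y : sl n) :
    ⁅rootVec i j h, ⁅rootVec i j h, ⁅rootVec i j h, y⁆⁆⁆ = 0 := by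
  have hs : (rootVec i j h).1 * (rootVec i j h).1 = 0 := by
    simp [rootVec, Matrix.single_mul_single_of_ne, h.symm]
  have hs' : ∀ z, (rootVec i j h).1 * ((rootVec i j h).1 * z) = 0 := fun z => by
    rw [← mul_assoc, hs, zero_mul]
  apply Subtype.ext
  simp only [LieSubalgebra.coe_bracket, Ring.lie_def, ZeroMemClass.coe_zero]
  simp [mul_sub, sub_mul, mul_assoc, hs, hs']

theorem exists_ad_e0 {n : ℕ} (k : Fin n) (r : USl n) :
    ∃ N : ℕ, (LieAlgebra.ad ℂ (USl n) (e0 k) ^ N) r = 0 := by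
  have : adNil (e0 k) = (⊤ : Subalgebra ℂ (USl n)) := ueaSubalgebra_eq_top _ fun y => by
    refine ⟨3, ?_⟩
    simp only [pow_succ, pow_zero, one_mul, Module.End.mul_apply, LieAlgebra.ad_apply, e0]
    rw [← LieHom.map_lie, ← LieHom.map_lie, ← LieHom.map_lie, rootVec_lie3, map_zero]
  exact (this ▸ Algebra.mem_top : r ∈ adNil (e0 k))

theorem oreS_ore {n : ℕ} (s : USl n) (hs : s ∈ oreS n) :
    ∀ r : USl n, ∃ t ∈ oreS n, ∃ r', t * r = r' * s := by
  induction hs using Submonoid.closure_induction with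
  | mem s hs =>
    obtain ⟨k, rfl⟩ := hs
    intro r
    obtain ⟨N, hN⟩ := exists_ad_e0 k r
    exact ⟨e0 k ^ N, pow_mem (e0_mem k) N, ore_num_of_ad _ _ N hN⟩
  | one => exact fun r => ⟨1, one_mem _, r, by simp⟩
  | mul a b _ _ iha ihb =>
    intro r
    obtain ⟨t, ht, r', h1⟩ := ihb r
    obtain ⟨u, hu, r'', h2⟩ := iha r'
    exact ⟨u * t, mul_mem hu ht, r'', by rw [mul_assoc, h1, ← mul_assoc, h2, mul_assoc]⟩

theorem oreS_cancel {n : ℕ} (s : USl n) (hs : s ∈ oreS n) :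
    ∀ r : USl n, r * s = 0 → ∃ t ∈ oreS n, t * r = 0 := by
  induction hs using Submonoid.closure_induction with
  | mem s hs =>
    obtain ⟨k, rfl⟩ := hs
    intro r hr
    obtain ⟨N, hN⟩ := exists_ad_e0 k r
    exact ⟨e0 k ^ N, pow_mem (e0_mem k) N, ore_cancel_of_ad _ _ N hN hr⟩
  | one => exact fun r hr => ⟨1, one_mem _, by simpa using hr⟩
  | mul a b _ _ iha ihb =>
    intro r hr
    obtain ⟨t, ht, h1⟩ := ihb (r * a) (by rwa [mul_assoc])
    obtain ⟨u, hu, h2⟩ := iha (t * r) (by rwa [mul_assoc])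
    exact ⟨u * t, mul_mem hu ht, by rwa [mul_assoc]⟩

/-- `S` is an Ore set, as every `ad e_{0k}` is locally nilpotent on `U(sl_{n+1})`. -/
instance oreSet (n : ℕ) : OreLocalization.OreSet (oreS n) where
  ore_right_cancel r₁ r₂ s h := by
    obtain ⟨t, ht, h1⟩ := oreS_cancel s s.2 (r₁ - r₂) (by rw [sub_mul, h, sub_self])
    exact ⟨⟨t, ht⟩, by rwa [mul_sub, sub_eq_zero] at h1⟩
  oreNum r s := (oreS_ore s s.2 r).choose_spec.2.choose
  oreDenom r s := ⟨(oreS_ore s s.2 r).choose, (oreS_ore s s.2 r).choose_spec.1⟩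
  ore_eq r s := (oreS_ore s s.2 r).choose_spec.2.choose_spec

/-- The localization `U_S` of `U(sl_{n+1})` at the Ore set `S`. -/
abbrev US (n : ℕ) : Type := OreLocalization (oreS n) (USl n)

/-- The localization map `U(sl_{n+1}) → U_S`. -/
def toUS (n : ℕ) : USl n →ₐ[ℂ] US n where
  __ := OreLocalization.numeratorRingHom
  commutes' _ := rfl

/-- `e_{0k}` as a unit of `U_S`. -/
def e0Unit {n : ℕ} (k : Fin n) : (US n)ˣ :=
  OreLocalization.numeratorUnit ⟨e0 k, e0_mem k⟩

theorem e0Unit_val {n : ℕ} (k : Fin n) : (e0Unit k : US n) = toUS n (e0 k) := rfl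

/-- The image in `U_S` of an element of `sl_{n+1}`. -/
def slUS {n : ℕ} (y : sl n) : US n := toUS n (UniversalEnvelopingAlgebra.ι ℂ y)

/-- The subalgebra `B` of `U_S` generated by all `h_i`, `e_{0k}` and `e_{0k}⁻¹`, `1 ≤ i, k ≤ n`. -/
def algB (n : ℕ) : Subalgebra ℂ (US n) :=
  Algebra.adjoin ℂ (Set.range (fun i : Fin n => slUS (hElt i.succ)) ∪
    Set.range (fun k : Fin n => (e0Unit k : US n)) ∪
    Set.range (fun k : Fin n => ((e0Unit k)⁻¹ : (US n)ˣ).val))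

/-- The algebra `W`: the centralizer of `B` in `U_S`. -/
def algW (n : ℕ) : Subalgebra ℂ (US n) := Subalgebra.centralizer ℂ (algB n : Set (US n))

section Weyl
variable {n : ℕ} {R : Type*} [Ring R] (x D : Fin n → R) (E : Fin n → Fin n → R)

/-- The operators `E i j + x i * D j` -/
def slM (i j : Fin n) : R := E i j + x i * D j

/-- The sum of the operators `E k k + x k * D k`. -/
def slC : R := ∑ k, slM x D E k k

/-- The images of the matrix units `e_{ij}`, `0 ≤ i, j ≤ n`, of `gl_{n+1}` (the identity is sent
to zero) -/
def slImg (i j : Fin (n + 1)) : R :=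
  Fin.cases (motive := fun _ => R)
    (Fin.cases (motive := fun _ => R) (-slC x D E) (fun j => -D j) j)
    (fun i => Fin.cases (motive := fun _ => R)
      (∑ q, x q * E i q + x i * slC x D E) (fun j => slM x D E i j) j) i

/-- The relations of the Weyl algebra in `x`, `D` and of `gl_n` in `E`, the two families commuting
with each other. -/
structure WeylGl : Prop where
  xx : ∀ i j, x i * x j = x j * x i
  DD : ∀ i j, D i * D j = D j * D i
  Dx : ∀ i j, D i * x j = x j * D i + if i = j then 1 else 0
  Ex : ∀ i j k, E i j * x k = x k * E i j
  ED : ∀ i j k, E i j * D k = D k * E i j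
  EE : ∀ i j k l, ⁅E i j, E k l⁆ =
    (if j = k then E i l else 0) - (if l = i then E k j else 0)

variable {x D E}

theorem lie_M_x (H : WeylGl x D E) (i j k : Fin n) : ⁅slM x D E i j, x k⁆ = if j = k then x i else 0 := by
  rw [Ring.lie_def, slM, add_mul, mul_add, H.Ex, mul_assoc, H.Dx, ← mul_assoc (x k), H.xx k i]
  split_ifs <;> noncomm_ring

theorem lie_M_D (H : WeylGl x D E) (i j k : Fin n) : ⁅slM x D E i j, D k⁆ = if k = i then -D j else 0 := by
  rw [Ring.lie_def, slM, add_mul, mul_add, H.ED, ← mul_assoc (D k), H.Dx, mul_assoc, H.DD j k]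
  split_ifs <;> noncomm_ring

theorem lie_M_E (H : WeylGl x D E) (i j k l : Fin n) : ⁅slM x D E i j, E k l⁆ =
    (if j = k then E i l else 0) - (if l = i then E k j else 0) := by
  rw [← H.EE, Ring.lie_def, Ring.lie_def, slM, add_mul, mul_add, mul_assoc (x i), ← H.ED,
    ← mul_assoc (x i), ← H.Ex]
  noncomm_ring

theorem lie_M_M (H : WeylGl x D E) (i j k l : Fin n) : ⁅slM x D E i j, slM x D E k l⁆ =
    (if j = k then slM x D E i l else 0) - (if l = i then slM x D E k j else 0) := by
  have h1 := lie_M_E H i j k l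
  have h2 : ⁅slM x D E i j, x k * D l⁆ = ⁅slM x D E i j, x k⁆ * D l
      + x k * ⁅slM x D E i j, D l⁆ := by
    simp only [Ring.lie_def]; noncomm_ring
  rw [lie_M_x H, lie_M_D H] at h2
  conv_lhs => rw [show slM x D E k l = E k l + x k * D l from rfl]
  rw [lie_add, h1, h2]
  simp only [slM]
  split_ifs <;> noncomm_ring

theorem lie_C_x (H : WeylGl x D E) (k : Fin n) : ⁅slC x D E, x k⁆ = x k := by
  rw [slC, sum_lie]; simp [lie_M_x H]

theorem lie_C_D (H : WeylGl x D E) (k : Fin n) : ⁅slC x D E, D k⁆ = -D k := by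
  rw [slC, sum_lie]; simp [lie_M_D H]

theorem lie_C_E (H : WeylGl x D E) (k l : Fin n) : ⁅slC x D E, E k l⁆ = 0 := by
  rw [slC, sum_lie]; simp [lie_M_E H, Finset.sum_sub_distrib]

theorem lie_C_M (H : WeylGl x D E) (k l : Fin n) : ⁅slC x D E, slM x D E k l⁆ = 0 := by
  rw [slC, sum_lie]; simp [lie_M_M H, Finset.sum_sub_distrib]

theorem lie_mul_gen (a b c : R) : ⁅a, b * c⁆ = ⁅a, b⁆ * c + b * ⁅a, c⁆ := by
  simp only [Ring.lie_def]; noncomm_ring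

theorem mul_lie_gen (a b c : R) : ⁅a * b, c⁆ = a * ⁅b, c⁆ + ⁅a, c⁆ * b := by
  simp only [Ring.lie_def]; noncomm_ring

variable (x D E) in
/-- The image of the matrix unit `e_{i0}`. -/
def slP (i : Fin n) : R := ∑ q, x q * E i q + x i * slC x D E

theorem lie_M_P (H : WeylGl x D E) (i j k : Fin n) :
    ⁅slM x D E i j, slP x D E k⁆ = if j = k then slP x D E i else 0 := by
  have hC : ⁅slM x D E i j, slC x D E⁆ = 0 := by
    rw [← lie_skew, lie_C_M H, neg_zero]
  simp only [slP, lie_add, lie_sum, lie_mul_gen, lie_M_x H, lie_M_E H, hC]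
  split_ifs <;> simp [mul_sub, Finset.sum_add_distrib, ite_mul]

theorem lie_C_P (H : WeylGl x D E) (k : Fin n) : ⁅slC x D E, slP x D E k⁆ = slP x D E k := by
  rw [slC, sum_lie]; simp [lie_M_P H]

theorem lie_P_D (H : WeylGl x D E) (i j : Fin n) :
    ⁅slP x D E i, D j⁆ = -slM x D E i j - if i = j then slC x D E else 0 := by
  have hx : ∀ q, ⁅x q, D j⁆ = -if j = q then 1 else 0 := fun q => by
    rw [Ring.lie_def, H.Dx]; abel
  have hE : ∀ k l, ⁅E k l, D j⁆ = 0 := fun k l => by rw [Ring.lie_def, H.ED, sub_self]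
  have h1 : ∀ q, ⁅x q * E i q, D j⁆ = if j = q then -E i j else 0 := fun q => by
    rw [mul_lie_gen, hE, hx]
    split_ifs with h
    · subst h; simp
    · simp
  rw [slP, add_lie, sum_lie, Finset.sum_congr rfl fun q _ => h1 q, mul_lie_gen, hx,
    lie_C_D H, slM]
  rcases eq_or_ne i j with h | h
  · subst h; simp; noncomm_ring
  · simp [h, h.symm]; abel

theorem lie_P_P (H : WeylGl x D E) (i k : Fin n) : ⁅slP x D E i, slP x D E k⁆ = 0 := by
  have hxxl : ∀ q p, ⁅x q, x p⁆ = 0 := fun q p => by rw [Ring.lie_def, H.xx, sub_self]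
  have hExl : ∀ q p r, ⁅E q p, x r⁆ = 0 := fun q p r => by rw [Ring.lie_def, H.Ex, sub_self]
  have hPx : ∀ r, ⁅slP x D E i, x r⁆ = x i * x r := fun r => by
    simp [slP, sum_lie, mul_lie_gen, hxxl, hExl, lie_C_x H]
  have hxE : ∀ q p r, ⁅x r, E q p⁆ = 0 := fun q p r => by rw [← lie_skew, hExl, neg_zero]
  have hPE : ∀ q, ⁅slP x D E i, E k q⁆
      = x k * E i q - if q = i then ∑ p, x p * E k p else 0 := fun q => by
    rw [slP, add_lie, sum_lie, mul_lie_gen, hxE, lie_C_E H]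
    simp only [mul_lie_gen, hxE, H.EE, zero_mul, mul_zero, add_zero, mul_sub,
      Finset.sum_sub_distrib]
    split_ifs <;> simp
  have hPC : ⁅slP x D E i, slC x D E⁆ = - slP x D E i := by
    rw [← lie_skew, lie_C_P H]
  have h1 : ∑ q, ⁅slP x D E i, x q * E k q⁆ = x k * ∑ q, x q * E i q := by
    have : ∀ q, ⁅slP x D E i, x q * E k q⁆
        = x i * (x q * E k q) + x k * (x q * E i q)
          - if q = i then x i * ∑ p, x p * E k p else 0 := fun q => by
      rw [lie_mul_gen, hPx, hPE, mul_sub, ← mul_assoc (x q) (x k), H.xx q k]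
      split_ifs with h
      · subst h; noncomm_ring
      · noncomm_ring
    rw [Finset.sum_congr rfl fun q _ => this q, Finset.sum_sub_distrib, Finset.sum_add_distrib,
      ← Finset.mul_sum, ← Finset.mul_sum]
    simp
  conv_lhs => rw [show slP x D E k = ∑ q, x q * E k q + x k * slC x D E from rfl]
  rw [lie_add, lie_sum, h1, lie_mul_gen, hPx, hPC, slP, H.xx i k]
  noncomm_ring

/-- The images of the matrix units satisfy the relations of `gl_{n+1}` -/
theorem lie_slImg (H : WeylGl x D E) (i j k l : Fin (n + 1)) : ⁅slImg x D E i j, slImg x D E k l⁆ =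
    (if j = k then slImg x D E i l else 0) - (if l = i then slImg x D E k j else 0) := by
  have hMD := lie_M_D H
  have hMM := lie_M_M H
  have hCD := lie_C_D H
  have hCM := lie_C_M H
  have hMP := lie_M_P H
  have hCP := lie_C_P H
  have hPD := lie_P_D H
  have hPP := lie_P_P H
  have hDM : ∀ k i j, ⁅D k, slM x D E i j⁆ = - if k = i then -D j else 0 := fun k i j => by
    rw [← lie_skew, hMD]
  have hDC : ∀ k, ⁅D k, slC x D E⁆ = D k := fun k => by rw [← lie_skew, hCD, neg_neg]
  have hMC : ∀ k l, ⁅slM x D E k l, slC x D E⁆ = 0 := fun k l => by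
    rw [← lie_skew, hCM, neg_zero]
  have hPM : ∀ k i j, ⁅slP x D E k, slM x D E i j⁆ = - if j = k then slP x D E i else 0 :=
    fun k i j => by rw [← lie_skew, hMP]
  have hPC : ∀ k, ⁅slP x D E k, slC x D E⁆ = -slP x D E k := fun k => by rw [← lie_skew, hCP]
  have hDP : ∀ j i, ⁅D j, slP x D E i⁆ = -(-slM x D E i j - if i = j then slC x D E else 0) :=
    fun j i => by rw [← lie_skew, hPD]
  have hDDl : ∀ i j, ⁅D i, D j⁆ = 0 := fun i j => by rw [Ring.lie_def, H.DD, sub_self]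
  have e1 : ∀ i : Fin n, ∑ q, x q * E i q + x i * slC x D E = slP x D E i := fun _ => rfl
  have h0 : ∀ i : Fin n, (0 : Fin (n + 1)) ≠ i.succ := fun i => (Fin.succ_ne_zero i).symm
  cases i using Fin.cases <;> cases j using Fin.cases <;> cases k using Fin.cases <;>
    cases l using Fin.cases <;>
    simp [slImg, e1, hMD, hMM, hCD, hCM, hMP, hCP, hPD, hPP, hDM, hDC, hMC, hPM, hPC, hDP, hDDl, h0]
  all_goals split_ifs <;> simp_all <;> abel


end Weyl

/-! ### The homomorphism from `W` to `U(gl_n)` -/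

/-- Functions on `ℤ^n` with values in `U(gl_n)`. Here `e_{0k}` acts as the shift `f(r) ↦ f(r + ε_k)` and
`h_k` as multiplication by `r_k + e_{kk}`; the other root vectors act by the formulas
`e_{ij} ↦ e_{ij} + x_i D_j` and `e_{i0} ↦ ∑ q, x_q e_{iq} + x_i ∑ q, (x_q D_q + e_{qq})`. -/
abbrev FMod (n : ℕ) : Type := (Fin n → ℤ) → UGl n
/-- The algebra of `ℂ`-linear operators on `FMod n`. -/
abbrev FEnd (n : ℕ) : Type := Module.End ℂ (FMod n)

/-- The element `e_{ij}` of `U(gl_n)`. -/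
def glU {n : ℕ} (i j : Fin n) : UGl n := UniversalEnvelopingAlgebra.ι ℂ (Matrix.single i j (1 : ℂ))

/-- The operator `(x_i f)(r) = -r_i f(r - ε_i)`. -/
def fX {n : ℕ} (i : Fin n) : FEnd n where
  toFun f r := -(r i : ℂ) • f (r - Pi.single i 1)
  map_add' f g := by ext r; simp
  map_smul' c f := by ext r; simp [smul_comm c]

/-- The operator `(D_i f)(r) = -f(r + ε_i)`; one has `[D_i, x_j] = δ_{ij}`. -/
def fD {n : ℕ} (i : Fin n) : FEnd n where
  toFun f r := -f (r + Pi.single i 1)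
  map_add' f g := by ext r; simp [add_comm]
  map_smul' c f := by ext r; simp

/-- Left multiplication by `e_{ij}`. -/
def fE {n : ℕ} (i j : Fin n) : FEnd n where
  toFun f r := glU i j * f r
  map_add' f g := by ext r; simp [mul_add]
  map_smul' c f := by ext r; simp

theorem glU_lie {n : ℕ} (i j k l : Fin n) : ⁅glU i j, glU k l⁆ =
    (if j = k then glU i l else 0) - (if l = i then glU k j else 0) := by
  rw [glU, glU, ← LieHom.map_lie, Ring.lie_def]
  by_cases h1 : j = k <;> by_cases h2 : l = i <;>
    simp [h1, h2, glU, Matrix.single_mul_single_of_ne, Matrix.single_mul_single_same]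

theorem slImg_lie {n : ℕ} (i j k l : Fin (n + 1)) :
    ⁅slImg (fX (n := n)) fD fE i j, slImg (fX (n := n)) fD fE k l⁆ =
    (if j = k then slImg (fX (n := n)) fD fE i l else 0)
      - (if l = i then slImg (fX (n := n)) fD fE k j else 0) := by
  refine lie_slImg ⟨?_, ?_, ?_, ?_, ?_, ?_⟩ i j k l
  · intro i j
    ext f r
    by_cases h : i = j
    · subst h; rfl
    · have h1 : ((Pi.single i 1 : Fin n → ℤ)) j = 0 := by simp [Ne.symm h]
      have h2 : ((Pi.single j 1 : Fin n → ℤ)) i = 0 := by simp [h]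
      simp [fX, h1, h2, smul_smul, mul_comm, sub_right_comm]
  · intro i j
    ext f r
    simp [fD, add_right_comm]
  · intro i j
    ext f r
    by_cases h : i = j
    · subst h
      simp [fD, fX, add_smul]
    · have h2 : ((Pi.single i 1 : Fin n → ℤ)) j = 0 := by simp [Ne.symm h]
      simp [fD, fX, h, add_sub_right_comm]
  · intro i j k
    ext f r
    simp [fE, fX]
  · intro i j k
    ext f r
    simp [fE, fD]
  · intro i j k l
    have h := glU_lie i j k l
    rw [Ring.lie_def] at h
    ext f r
    have h' := congrArg (fun v => v * f r) h
    have e : ∀ a b c d : Fin n, (fE a b * fE c d : FEnd n) f r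
        = glU a b * glU c d * f r := fun a b c d => by
      simp [fE, mul_assoc]
    rw [Ring.lie_def, LinearMap.sub_apply, Pi.sub_apply, e, e, ← sub_mul, h', sub_mul]
    split_ifs <;> simp [fE]

/-- The representation on `FMod n`, written on all of `gl_{n+1}` (the identity matrix acts as zero). -/
def psiLin (n : ℕ) : Matrix (Fin (n + 1)) (Fin (n + 1)) ℂ →ₗ[ℂ] FEnd n where
  toFun Y := ∑ i, ∑ j, Y i j • slImg fX fD fE i j
  map_add' Y Z := by simp [add_smul, Finset.sum_add_distrib]
  map_smul' c Y := by simp [mul_smul, Finset.smul_sum]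

theorem psiLin_single {n : ℕ} (i j : Fin (n + 1)) (c : ℂ) :
    psiLin n (Matrix.single i j c) = c • slImg fX fD fE i j := by
  change ∑ k, ∑ l, (Matrix.single i j c) k l • slImg fX fD fE k l = _
  simp [Matrix.single_apply, ite_and, ite_smul]

theorem psiLin_lie {n : ℕ} (Y Z : Matrix (Fin (n + 1)) (Fin (n + 1)) ℂ) :
    psiLin n ⁅Y, Z⁆ = ⁅psiLin n Y, psiLin n Z⁆ := by
  induction Y using Matrix.induction_on' with
  | h_zero => simp
  | h_add p q hp hq => rw [add_lie, map_add, map_add, add_lie, hp, hq]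
  | h_std_basis i j a =>
    induction Z using Matrix.induction_on' with
    | h_zero => simp
    | h_add p q hp hq => rw [lie_add, map_add, map_add, lie_add, hp, hq]
    | h_std_basis k l b =>
      have hs : ∀ X Y : FEnd n, ⁅a • X, b • Y⁆ = (a * b) • ⁅X, Y⁆ := fun X Y => by
        ext f r
        simp [Ring.lie_def, smul_sub, smul_smul, mul_comm b a]
      rw [psiLin_single, psiLin_single, hs, slImg_lie, Ring.lie_def, map_sub]
      by_cases h1 : j = k <;> by_cases h2 : l = i <;>
        simp [h1, h2, Matrix.single_mul_single_of_ne, Matrix.single_mul_single_same, psiLin_single,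
          mul_comm b a, smul_sub]

/-- The representation of `sl_{n+1}` on `FMod n`. -/
def psi (n : ℕ) : sl n →ₗ⁅ℂ⁆ FEnd n where
  toLinearMap := (psiLin n).comp (sl n).subtype
  map_lie' {Y Z} := psiLin_lie Y.1 Z.1

theorem isUnit_fD {n : ℕ} (k : Fin n) : IsUnit (-fD k : FEnd n) := by
  rw [Module.End.isUnit_iff]
  refine ⟨fun f g h => ?_, fun f => ⟨fun r => f (r - Pi.single k 1), ?_⟩⟩
  · ext r
    have h1 := congrFun h (r - Pi.single k 1)
    simp only [fD, LinearMap.neg_apply, LinearMap.coe_mk, AddHom.coe_mk, Pi.neg_apply, neg_neg,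
      sub_add_cancel] at h1
    exact h1
  · ext r
    simp [fD]

/-- The representation of `U(sl_{n+1})` on `FMod n`. -/
def psiU (n : ℕ) : USl n →ₐ[ℂ] FEnd n := UniversalEnvelopingAlgebra.lift ℂ (psi n)

theorem psiU_e0 {n : ℕ} (k : Fin n) : psiU n (e0 k) = -fD k := by
  rw [psiU, e0, UniversalEnvelopingAlgebra.lift_ι_apply]
  change psiLin n (Matrix.single _ _ _) = _
  rw [psiLin_single, one_smul]
  rfl

theorem psiU_isUnit {n : ℕ} (s : oreS n) : IsUnit (psiU n s) := by
  obtain ⟨s, hs⟩ := s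
  induction hs using Submonoid.closure_induction with
  | mem s hs =>
    obtain ⟨k, rfl⟩ := hs
    change IsUnit (psiU n (e0 k))
    rw [psiU_e0]
    exact isUnit_fD k
  | one =>
    change IsUnit (psiU n 1)
    rw [map_one]; exact isUnit_one
  | mul a b _ _ iha ihb =>
    change IsUnit (psiU n (a * b))
    rw [map_mul]; exact iha.mul ihb

/-- The operators by which `S` acts are invertible. -/
def psiUSUnits (n : ℕ) : oreS n →* (FEnd n)ˣ where
  toFun s := (psiU_isUnit s).unit
  map_one' := Units.ext (map_one (psiU n))
  map_mul' s t := Units.ext (map_mul (psiU n) s.1 t.1)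

/-- The representation of `U_S` on `FMod n`. -/
def psiUS (n : ℕ) : US n →ₐ[ℂ] FEnd n where
  __ := OreLocalization.universalHom (psiU n).toRingHom (psiUSUnits n) (fun _ => rfl)
  commutes' r := (OreLocalization.universalHom_commutes (psiU n).toRingHom (psiUSUnits n)
    (fun _ => rfl)).trans ((psiU n).commutes r)

theorem psiUS_toUS {n : ℕ} (u : USl n) : psiUS n (toUS n u) = psiU n u :=
  OreLocalization.universalHom_commutes (psiU n).toRingHom (psiUSUnits n) (fun _ => rfl)

/-- The operators commuting with right multiplication by the function of constant value `a` -/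
def rightComm {n : ℕ} (a : UGl n) : Subalgebra ℂ (FEnd n) :=
  Subalgebra.centralizer ℂ {LinearMap.mulRight ℂ (fun _ : Fin n → ℤ => a)}

theorem psiUS_rightComm {n : ℕ} (a : UGl n) (u : US n) : psiUS n u ∈ rightComm a := by
  have hC : ∀ T : FEnd n, T ∈ rightComm a ↔
      Commute (LinearMap.mulRight ℂ (fun _ : Fin n → ℤ => a)) T := by
    intro T
    simp [rightComm, Subalgebra.mem_centralizer_iff, Commute, SemiconjBy]
  have hX : ∀ i, fX i ∈ rightComm a := fun i => by
    rw [hC]; ext f r; simp [fX]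
  have hD : ∀ i, fD i ∈ rightComm a := fun i => by
    rw [hC]; ext f r; simp [fD]
  have hE : ∀ i j, fE i j ∈ rightComm a := fun i j => by
    rw [hC]; ext f r; simp [fE, mul_assoc]
  have hM : ∀ i j, slM fX fD fE i j ∈ rightComm a := fun i j =>
    add_mem (hE i j) (mul_mem (hX i) (hD j))
  have hCC : slC fX fD fE ∈ rightComm a := sum_mem fun k _ => hM k k
  have hI : ∀ i j, slImg fX fD fE i j ∈ rightComm a := fun i j => by
    cases i using Fin.cases with
    | zero =>
      cases j using Fin.cases with
      | zero => exact neg_mem hCC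
      | succ j => exact neg_mem (hD j)
    | succ i =>
      cases j using Fin.cases with
      | zero => exact add_mem (sum_mem fun q _ => mul_mem (hX q) (hE i q)) (mul_mem (hX i) hCC)
      | succ j => exact hM i j
  have hU : ∀ v : USl n, psiU n v ∈ rightComm a := fun v => by
    have : (rightComm a).comap (psiU n) = ⊤ := ueaSubalgebra_eq_top _ fun y => by
      change psiU n _ ∈ rightComm a
      rw [psiU, UniversalEnvelopingAlgebra.lift_ι_apply]
      exact sum_mem fun i _ => sum_mem fun j _ => Subalgebra.smul_mem _ (hI i j) _
    exact (this ▸ Algebra.mem_top : v ∈ (rightComm a).comap (psiU n))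
  induction u using OreLocalization.ind with
  | _ r s =>
    rw [hC]
    refine Commute.mul_right (Commute.units_inv_right ?_) ((hC _).1 (hU r))
    exact (hC _).1 (hU s)

/-- The value at `0` of the function `u · 1`. -/
def tauFun (n : ℕ) (u : US n) : UGl n := psiUS n u 1 0

theorem psiUS_e0Unit {n : ℕ} (k : Fin n) : psiUS n (e0Unit k) = -fD k :=
  (psiUS_toUS _).trans (psiU_e0 k)

theorem psiUS_algW_one {n : ℕ} (w : US n) (hw : w ∈ algW n) (r : Fin n → ℤ) :
    psiUS n w 1 r = tauFun n w := by
  have hper : ∀ (k : Fin n) (r : Fin n → ℤ),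
      psiUS n w 1 (r + Pi.single k 1) = psiUS n w 1 r := fun k r => by
    have h := (Subalgebra.mem_centralizer_iff ℂ).1 hw (e0Unit k : US n)
      (Algebra.subset_adjoin (Or.inl (Or.inr ⟨k, rfl⟩)))
    have h1 := congrFun (LinearMap.congr_fun (congrArg (psiUS n) h) 1) r
    rw [map_mul, map_mul, psiUS_e0Unit, Module.End.mul_apply, Module.End.mul_apply] at h1
    have h2 : (-fD k : FEnd n) 1 = 1 := by ext r; simp [fD]
    rw [h2] at h1
    simpa [fD] using h1
  have hper' : ∀ (k : Fin n) (m : ℤ) (r : Fin n → ℤ),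
      psiUS n w 1 (r + m • Pi.single k 1) = psiUS n w 1 r := fun k m => by
    induction m with
    | zero => simp
    | succ m ih => intro r; rw [add_smul, one_smul, ← add_assoc, hper, ih]
    | pred m ih => intro r; rw [← hper k, sub_smul, one_smul, add_assoc, sub_add_cancel, ih]
  have hs : ∀ (s : Finset (Fin n)),
      psiUS n w 1 (∑ k ∈ s, r k • Pi.single k 1) = tauFun n w := fun s => by
    induction s using Finset.induction_on with
    | empty => rfl
    | insert k s hk ih => rw [Finset.sum_insert hk, add_comm (r k • Pi.single k 1), hper', ih]
  have hr : r = ∑ k, r k • (Pi.single k 1 : Fin n → ℤ) := by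
    ext j; simp [Finset.sum_apply, Pi.single_apply]
  rw [← hs Finset.univ, ← hr]

/-- The algebra homomorphism `τ : W → U(gl_n)`. The constant functions are the vectors of `FMod n` on
which all `e_{0k}` act as the identity. `W` commutes with the `e_{0k}`, so it preserves this space
`U(gl_n)`, and it acts there by left multiplication by `τ(w) = w · 1`. On the generators of `W` this is
`x_{ij} ↦ e_{ij} - e_{ii}` and `ω_k ↦ ∑ j, (e_{kj} e_{jj} - e_{kj})`: see `tau_xElt` and `tau_omegaElt`. -/
def tau (n : ℕ) : algW n →ₐ[ℂ] UGl n where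
  toFun w := tauFun n w
  map_one' := by simp [tauFun]
  map_zero' := by simp [tauFun]
  map_add' a b := by simp [tauFun]
  commutes' c := by
    have : ((algebraMap ℂ (algW n) c : algW n) : US n) = algebraMap ℂ (US n) c := rfl
    simp [tauFun, Algebra.algebraMap_eq_smul_one]
  map_mul' a b := by
    have h1 : psiUS n b.1 1 = LinearMap.mulRight ℂ (fun _ : Fin n → ℤ => tauFun n b.1) 1 := by
      ext r; simpa using psiUS_algW_one b.1 b.2 r
    have h2 := (Subalgebra.mem_centralizer_iff ℂ).1 (psiUS_rightComm (tauFun n b.1) a.1) _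
      (Set.mem_singleton _)
    have h3 := congrFun (LinearMap.congr_fun h2 1) 0
    change psiUS n (a.1 * b.1) 1 0 = _
    rw [map_mul, Module.End.mul_apply, h1]
    exact h3.symm

/-! ### The generators of `W` and their images -/

/-- The element `x_{ij} = e_{ij} e_{0i} e_{0j}⁻¹ - h_i` of `U_S`, `1 ≤ i ≠ j ≤ n`. -/
def xElt {n : ℕ} (i j : Fin n) (h : i ≠ j) : US n :=
  slUS (rootVec i.succ j.succ (by simpa using h)) * (e0Unit i : US n) *
    ((e0Unit j)⁻¹ : (US n)ˣ).val - slUS (hElt i.succ)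

/-- `e_{kj} - (δ_{kj} / (n + 1)) I_{n+1}` in `sl_{n+1}`, `1 ≤ k, j ≤ n`. -/
def eOrH {n : ℕ} (k j : Fin n) : sl n :=
  if h : k = j then hElt k.succ else rootVec k.succ j.succ (by simpa using h)

/-- The element `ω_k = e_{k0} e_{0k} + ∑ j, (e_{kj} - (δ_{kj} / (n + 1)) I_{n+1}) (h_j - 1) e_{0k} e_{0j}⁻¹`
of `U_S`, `1 ≤ k ≤ n`. -/
def omegaElt {n : ℕ} (k : Fin n) : US n :=
  slUS (rootVec k.succ 0 (Fin.succ_ne_zero k)) * (e0Unit k : US n) +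
    ∑ j, slUS (eOrH k j) * (slUS (hElt j.succ) - 1) * (e0Unit k : US n) *
      ((e0Unit j)⁻¹ : (US n)ˣ).val

/-- The element `γ_i = ∑ j, (e_{ij} e_{jj} - e_{ij})` of `U(gl_n)`. -/
def gammaElt {n : ℕ} (i : Fin n) : UGl n := ∑ j, (glU i j * glU j j - glU i j)

theorem slUS_add {n : ℕ} (y z : sl n) : slUS (y + z) = slUS y + slUS z := by
  rw [slUS, map_add, map_add]; rfl

theorem slUS_lie {n : ℕ} (y z : sl n) : slUS ⁅y, z⁆ = slUS y * slUS z - slUS z * slUS y := by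
  rw [slUS, LieHom.map_lie, Ring.lie_def, map_sub, map_mul, map_mul]; rfl

theorem slUS_mul {n : ℕ} (y z : sl n) : slUS y * slUS z = slUS z * slUS y + slUS ⁅y, z⁆ := by
  rw [slUS_lie]; abel

theorem mem_algW_iff {n : ℕ} (u : US n) : u ∈ algW n ↔
    (∀ i : Fin n, Commute (slUS (hElt i.succ)) u) ∧ ∀ k : Fin n, Commute (e0Unit k : US n) u := by
  constructor
  · intro hu
    rw [algW, Subalgebra.mem_centralizer_iff] at hu
    exact ⟨fun i => hu _ (Algebra.subset_adjoin (Or.inl (Or.inl ⟨i, rfl⟩))),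
      fun k => hu _ (Algebra.subset_adjoin (Or.inl (Or.inr ⟨k, rfl⟩)))⟩
  · rintro ⟨h1, h2⟩
    rw [algW, Subalgebra.mem_centralizer_iff]
    intro g hg
    have : algB n ≤ Subalgebra.centralizer ℂ {u} := by
      apply Algebra.adjoin_le
      rintro x ((⟨i, rfl⟩ | ⟨k, rfl⟩) | ⟨k, rfl⟩) <;>
        rw [SetLike.mem_coe, Subalgebra.mem_centralizer_iff] <;> rintro _ rfl
      · exact (h1 i).symm
      · exact (h2 k).symm
      · exact ((h2 k).units_inv_left).symm
    exact ((Subalgebra.mem_centralizer_iff ℂ).1 (this hg) u rfl).symm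

/-- The image of the matrix unit `e_{ij}` under the projection `gl_{n+1} → sl_{n+1}` along the scalars. -/
def glv {n : ℕ} (i j : Fin (n+1)) : sl n := if h : i = j then hElt i else rootVec i j h

theorem glv_val {n : ℕ} (i j : Fin (n+1)) : (glv i j).1 = Matrix.single i j (1:ℂ) - if i = j then (1 / ((n : ℂ) + 1)) • (1 : Matrix (Fin (n + 1)) (Fin (n + 1)) ℂ) else 0 := by
  by_cases h : i = j
  · subst h; simp [glv, hElt]
  · simp [glv, h, rootVec]

theorem glv_lie {n : ℕ} (i j k l : Fin (n+1)) : ⁅(glv i j : sl n), glv k l⁆ =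
   (if j = k then glv i l else 0) - (if l = i then glv k j else 0) := by
  apply Subtype.ext
  have e : ∀ (p : Prop) [Decidable p] (a : sl n), ((if p then a else 0 : sl n) : Matrix (Fin (n + 1)) (Fin (n + 1)) ℂ) = if p then a.1 else 0 := fun p _ a => by split_ifs <;> rfl
  rw [LieSubalgebra.coe_bracket, Ring.lie_def]
  change _ = (_ : Matrix (Fin (n + 1)) (Fin (n + 1)) ℂ) - _
  rw [e, e, glv_val, glv_val, glv_val, glv_val]
  have c : ∀ (p q : Prop) [Decidable p] [Decidable q] (A B : Matrix (Fin (n + 1)) (Fin (n + 1)) ℂ) (t : ℂ),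
     (A - if p then t • 1 else 0) * (B - if q then t • 1 else 0) - (B - if q then t • 1 else 0) * (A - if p then t • 1 else 0) = A * B - B * A := by
    intros; split_ifs <;> simp [sub_mul, mul_sub, smul_sub]; abel
  rw [c]
  by_cases h1 : j = k <;> by_cases h2 : l = i
  · subst h1 h2; by_cases h3 : j = l
    · subst h3; simp
    · simp [h3, Ne.symm h3]
  · subst h1; simp [h2, Ne.symm h2, Matrix.single_mul_single_of_ne]
  · subst h2; simp [h1, Ne.symm h1, Matrix.single_mul_single_of_ne]
  · simp [h1, h2, Matrix.single_mul_single_of_ne]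

theorem glv_h {n : ℕ} (i : Fin (n+1)) : hElt i = (glv i i : sl n) := by simp [glv]
theorem glv_root {n : ℕ} (i j : Fin (n+1)) (h : i ≠ j) : rootVec i j h = glv i j := by simp [glv, h]
theorem e0_glv {n : ℕ} (k : Fin n) : (e0Unit k : US n) = slUS (glv 0 k.succ) := by
  rw [← glv_root _ _ (Fin.succ_ne_zero k).symm]; rfl
theorem glv_eOrH {n : ℕ} (k j : Fin n) : eOrH k j = glv k.succ j.succ := by
  simp [eOrH, glv]
theorem slUS_zero {n : ℕ} : slUS (0 : sl n) = 0 := by simp [slUS]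
theorem slUS_neg {n : ℕ} (y : sl n) : slUS (-y) = - slUS y := by simp [slUS]

theorem gl_e0 {n : ℕ} (i j : Fin n) (k : Fin n) : slUS (glv i.succ j.succ) * (e0Unit k : US n) =
    e0Unit k * slUS (glv i.succ j.succ) - if k = i then (e0Unit j : US n) else 0 := by
  rw [e0_glv, e0_glv, slUS_mul, glv_lie]
  have : (j.succ = (0:Fin (n+1))) = False := by simp [Fin.succ_ne_zero]
  simp only [Fin.succ_inj, this, if_false, zero_sub]
  split_ifs <;> simp [slUS_neg, slUS_zero, sub_eq_add_neg]

theorem e0_comm {n : ℕ} (i j : Fin n) : Commute (e0Unit i : US n) (e0Unit j) := by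
  rw [Commute, SemiconjBy, e0_glv, e0_glv, slUS_mul, glv_lie]
  simp [slUS_zero, Fin.succ_ne_zero]

theorem h_gl {n : ℕ} (a i j : Fin (n+1)) : slUS (glv a a) * slUS (glv i j) =
    slUS (glv i j) * slUS (glv a a) + (if a = i then slUS (glv i j : sl n) else 0) - (if a = j then slUS (glv i j) else 0) := by
  rw [slUS_mul, glv_lie]
  by_cases h1 : a = i <;> by_cases h2 : a = j
  · subst h1 h2; simp [slUS_zero]
  · subst h1; simp [h2, Ne.symm h2]
  · subst h2; simp [h1, slUS_neg]; abel
  · simp [h1, h2, Ne.symm h2, slUS_zero]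

/-- `u` is an eigenvector of `ad h_a` with eigenvalue `c`. -/
def wt {n : ℕ} (a : Fin n) (c : ℤ) (u : US n) : Prop :=
  slUS (hElt a.succ) * u = u * slUS (hElt a.succ) + c • u

theorem wt.mul {n : ℕ} {a : Fin n} {c d : ℤ} {u v : US n} (hu : wt a c u) (hv : wt a d v) : wt a (c+d) (u*v) := by
  unfold wt at *
  rw [← mul_assoc, hu, add_mul, mul_assoc, hv, add_smul]
  simp only [mul_add, mul_assoc, smul_mul_assoc, mul_smul_comm]; abel

theorem wt_inv {n : ℕ} {a : Fin n} {c : ℤ} {u : (US n)ˣ} (hu : wt a c u.val) : wt a (-c) (u⁻¹).val := by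
  unfold wt at *
  have := congrArg (fun x => (u⁻¹).val * x * (u⁻¹).val) hu
  simp only [mul_add, add_mul, ← mul_assoc, Units.inv_mul, one_mul] at this
  simp only [mul_assoc, Units.mul_inv, mul_one, mul_smul_comm, smul_mul_assoc] at this
  rw [this]; simp

theorem wt_gl {n : ℕ} (a : Fin n) (i j : Fin (n+1)) : wt a ((if a.succ = i then 1 else 0) - (if a.succ = j then 1 else 0)) (slUS (glv i j)) := by
  unfold wt
  rw [glv_h, h_gl]
  split_ifs <;> simp; abel

theorem wt_e0 {n : ℕ} (a k : Fin n) : wt a (-(if a = k then 1 else 0)) (e0Unit k : US n) := by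
  have := wt_gl a 0 k.succ
  rw [e0_glv]
  convert this using 1
  simp [Fin.succ_ne_zero]

theorem wt.zero {n : ℕ} {a : Fin n} {c : ℤ} {u : US n} (h : wt a c u) (hc : c = 0) : Commute (slUS (hElt a.succ)) u := by
  subst hc; unfold wt at h; rw [zero_smul, add_zero] at h; exact h

/-- `x_{ij}` belongs to `W`. -/
theorem xElt_mem {n : ℕ} (i j : Fin n) (h : i ≠ j) : xElt i j h ∈ algW n := by
  rw [mem_algW_iff]
  constructor
  · intro a
    refine Commute.sub_right ?_ ?_
    · rw [glv_root]
      refine wt.zero (((wt_gl a i.succ j.succ).mul (wt_e0 a i)).mul (wt_inv (wt_e0 a j))) ?_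
      simp only [Fin.succ_inj]; ring
    · have := wt_gl a i.succ i.succ
      rw [← glv_h] at this
      exact this.zero (by ring)
  · intro k
    have h1 := gl_e0 i j k
    have h2 := gl_e0 i i k
    rw [Commute, SemiconjBy, xElt, glv_root, glv_h, mul_sub, sub_mul]
    have h3 : slUS (glv i.succ j.succ) * (e0Unit i : US n) * ((e0Unit j)⁻¹ : (US n)ˣ).val * (e0Unit k)
      = slUS (glv i.succ j.succ) * (e0Unit k) * (e0Unit i : US n) * ((e0Unit j)⁻¹ : (US n)ˣ).val := by
      rw [mul_assoc, ((e0_comm j k).units_inv_left).eq, ← mul_assoc, mul_assoc _ (e0Unit i : US n), (e0_comm i k).eq, ← mul_assoc]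
    rw [h3, h1, h2]
    simp only [sub_mul, mul_assoc]
    split_ifs with hk
    · subst hk
      rw [((e0_comm k j).units_inv_right).eq]
      simp
    · simp

theorem slUS_h_zero {n : ℕ} : slUS (glv (0 : Fin (n+1)) 0) = - ∑ j : Fin n, slUS (glv j.succ j.succ) := by
  have : ∑ j : Fin (n+1), glv j j = (0 : sl n) := by
    apply Subtype.ext
    have : ((∑ j : Fin (n+1), glv j j : sl n) : Matrix (Fin (n + 1)) (Fin (n + 1)) ℂ) = ∑ j, (glv j j : sl n).1 := by
      simp
    rw [this]
    have hn : ((n:ℂ)+1) ≠ 0 := by exact_mod_cast Nat.succ_ne_zero n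
    simp only [glv_val, if_true, Finset.sum_sub_distrib, Finset.sum_const, Finset.card_univ, Fintype.card_fin]
    have h1 : ∑ j : Fin (n + 1), Matrix.single j j (1 : ℂ) = 1 := by
      ext a b
      by_cases hab : a = b <;> simp [Matrix.sum_apply, Matrix.single_apply, Matrix.one_apply, hab]
    rw [h1, ← Nat.cast_smul_eq_nsmul ℂ, smul_smul]
    simp [hn]
  rw [Fin.sum_univ_succ] at this
  have h2 := congrArg slUS this
  rw [slUS_add, slUS_zero] at h2
  rw [eq_neg_of_add_eq_zero_left h2]
  simp [slUS]

/-- `ω_k` belongs to `W`. -/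
theorem omegaElt_mem {n : ℕ} (k : Fin n) : omegaElt k ∈ algW n := by
  rw [mem_algW_iff]
  have hroot := glv_root k.succ 0 (Fin.succ_ne_zero k)
  constructor
  · intro a
    refine Commute.add_right ?_ (Commute.sum_right _ _ _ fun j _ => ?_)
    · rw [hroot]
      refine wt.zero ((wt_gl a k.succ 0).mul (wt_e0 a k)) ?_
      simp [Fin.succ_ne_zero]
    · have hh : wt a 0 (slUS (hElt j.succ) - 1) := by
        have := wt_gl a j.succ j.succ
        rw [← glv_h] at this
        unfold wt at *
        rw [mul_sub, this, sub_mul]; simp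
      rw [glv_eOrH]
      refine wt.zero ((((wt_gl a k.succ j.succ).mul hh).mul (wt_e0 a k)).mul (wt_inv (wt_e0 a j))) ?_
      simp only [Fin.succ_inj]; ring
  · intro l
    rw [Commute, SemiconjBy, omegaElt, hroot, mul_add, add_mul, Finset.mul_sum, Finset.sum_mul]
    have h1 : slUS (glv k.succ 0) * (e0Unit k : US n) * (e0Unit l) = e0Unit l * (slUS (glv k.succ 0) * (e0Unit k : US n)) + slUS (glv k.succ l.succ) * e0Unit k - (if k = l then slUS (glv 0 0) * (e0Unit k : US n) else 0) := by
      rw [mul_assoc, (e0_comm k l).eq, ← mul_assoc, e0_glv l, slUS_mul, glv_lie, if_pos rfl]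
      by_cases hkl : k = l
      · subst hkl
        rw [if_pos rfl, if_pos rfl, sub_eq_add_neg, slUS_add, slUS_neg, add_mul, add_mul, neg_mul, mul_assoc]; abel
      · rw [if_neg (by simpa using Ne.symm hkl), if_neg hkl, sub_zero, sub_zero, add_mul, mul_assoc]
    have h2 : ∀ j, slUS (eOrH k j) * (slUS (hElt j.succ) - 1) * (e0Unit k : US n) * ((e0Unit j)⁻¹ : (US n)ˣ).val * e0Unit l =
      e0Unit l * (slUS (eOrH k j) * (slUS (hElt j.succ) - 1) * (e0Unit k : US n) * ((e0Unit j)⁻¹ : (US n)ˣ).val)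
       - (if j = l then slUS (glv k.succ l.succ) * (e0Unit k : US n) else 0) - (if k = l then slUS (glv j.succ j.succ) * (e0Unit k : US n) else 0) := by
      intro j
      have e1 : slUS (eOrH k j) * (slUS (hElt j.succ) - 1) * (e0Unit k : US n) * ((e0Unit j)⁻¹ : (US n)ˣ).val * e0Unit l
        = slUS (eOrH k j) * ((slUS (hElt j.succ) - 1) * (e0Unit l)) * (e0Unit k : US n) * ((e0Unit j)⁻¹ : (US n)ˣ).val := by
        rw [mul_assoc, ((e0_comm j l).units_inv_left).eq, ← mul_assoc, mul_assoc _ (e0Unit k : US n), (e0_comm k l).eq]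
        simp only [mul_assoc]
      have e2 : (slUS (hElt j.succ) - 1) * (e0Unit l : US n) = e0Unit l * (slUS (hElt j.succ) - 1) - if j = l then (e0Unit l : US n) else 0 := by
        rw [glv_h, sub_mul, gl_e0]
        by_cases hjl : j = l
        · subst hjl; simp [mul_sub, sub_right_comm]
        · simp [hjl, Ne.symm hjl, mul_sub]
      have e3 : ∀ y : US n, slUS (eOrH k j) * ((e0Unit l : US n) * y) = e0Unit l * (slUS (eOrH k j) * y) - if k = l then (e0Unit j : US n) * y else 0 := by
        intro y
        rw [← mul_assoc, glv_eOrH, gl_e0, sub_mul, mul_assoc]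
        by_cases hkl : k = l
        · subst hkl; simp
        · simp [hkl, Ne.symm hkl]
      have e4 : (e0Unit j : US n) * (slUS (hElt j.succ) - 1) = slUS (hElt j.succ) * e0Unit j := by
        rw [glv_h, gl_e0]; simp [mul_sub]
      have e5 : (e0Unit j : US n) * (slUS (hElt j.succ) - 1) * (e0Unit k : US n) * ((e0Unit j)⁻¹ : (US n)ˣ).val = slUS (glv j.succ j.succ) * e0Unit k := by
        rw [e4, mul_assoc _ (e0Unit j : US n), (e0_comm j k).eq, glv_h]; simp [mul_assoc]
      rw [e1, e2, mul_sub, e3]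
      by_cases hjl : j = l
      · subst hjl
        have e6 : slUS (eOrH k j) * (e0Unit j : US n) * (e0Unit k : US n) * ((e0Unit j)⁻¹ : (US n)ˣ).val = slUS (glv k.succ j.succ) * e0Unit k := by
          rw [mul_assoc _ (e0Unit j : US n), (e0_comm j k).eq, glv_eOrH]; simp [mul_assoc]
        by_cases hkj : k = j
        · simp only [hkj, if_true, sub_mul] at *
          rw [e5, e6]; simp only [mul_assoc]
        · simp only [hkj, if_true, if_false, sub_mul, sub_zero]
          rw [e6]; simp only [mul_assoc]
      · by_cases hkl : k = l
        · simp only [hjl, hkl, if_true, if_false, sub_mul, sub_zero, mul_zero, zero_mul] at *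
          rw [e5]; simp only [mul_assoc]
        · simp only [hjl, hkl, if_false, sub_mul, sub_zero, mul_zero, zero_mul, mul_assoc]
    rw [h1, Finset.sum_congr rfl fun j _ => h2 j]
    simp only [Finset.sum_sub_distrib, Finset.sum_ite_eq', Finset.mem_univ, if_true]
    by_cases hkl : k = l
    · subst hkl
      simp only [if_true, ← Finset.sum_mul, slUS_h_zero, neg_mul, Finset.mul_sum]; abel
    · simp only [hkl, if_false, Finset.sum_const_zero]; abel

theorem psiLin_one (n : ℕ) : psiLin n 1 = 0 := by
  change ∑ i, ∑ j, (1 : Matrix (Fin (n + 1)) (Fin (n + 1)) ℂ) i j • slImg fX fD fE i j = _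
  simp only [Matrix.one_apply, ite_smul, one_smul, zero_smul, Finset.sum_ite_eq, Finset.mem_univ,
    if_true]
  rw [Fin.sum_univ_succ]
  exact neg_add_cancel _

theorem psiUS_sl {n : ℕ} (y : sl n) : psiUS n (slUS y) = psiLin n y.1 := by
  rw [slUS, psiUS_toUS, psiU, UniversalEnvelopingAlgebra.lift_ι_apply]; rfl

theorem psiUS_h {n : ℕ} (i : Fin n) : psiUS n (slUS (hElt i.succ)) = slM fX fD fE i i := by
  rw [psiUS_sl]
  change psiLin n (_ - _ • _) = _
  rw [map_sub, map_smul, psiLin_one, smul_zero, sub_zero, psiLin_single, one_smul]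
  rfl

theorem psiUS_root {n : ℕ} (i j : Fin (n + 1)) (h : i ≠ j) :
    psiUS n (slUS (rootVec i j h)) = slImg fX fD fE i j := by
  rw [psiUS_sl]
  change psiLin n (Matrix.single _ _ _) = _
  rw [psiLin_single, one_smul]

theorem psiUS_eOrH {n : ℕ} (i j : Fin n) : psiUS n (slUS (eOrH i j)) = slM fX fD fE i j := by
  rw [eOrH]
  split_ifs with h
  · subst h; exact psiUS_h i
  · exact psiUS_root _ _ _

theorem psiUS_e0_one {n : ℕ} (k : Fin n) : psiUS n (e0Unit k) 1 = 1 := by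
  rw [psiUS_e0Unit]; ext r; simp [fD]

theorem psiUS_e0_inv_one {n : ℕ} (k : Fin n) : psiUS n ((e0Unit k)⁻¹ : (US n)ˣ).val 1 = 1 := by
  conv_lhs => rw [← psiUS_e0_one k]
  rw [← Module.End.mul_apply, ← map_mul, Units.inv_mul]
  exact LinearMap.congr_fun (map_one (psiUS n)) 1

theorem slM_apply {n : ℕ} (i j : Fin n) (f : FMod n) (r : Fin n → ℤ) :
    slM fX fD fE i j f r = glU i j * f r + (r i : ℂ) • f (r - Pi.single i 1 + Pi.single j 1) := by
  simp [slM, fX, fD, fE]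

theorem tau_xElt {n : ℕ} (i j : Fin n) (h : i ≠ j) :
    tau n ⟨xElt i j h, xElt_mem i j h⟩ = glU i j - glU i i := by
  change psiUS n (xElt i j h) 1 0 = _
  simp only [xElt, map_sub, map_mul, Module.End.mul_apply, psiUS_e0_inv_one, psiUS_e0_one,
    psiUS_h, psiUS_root, LinearMap.sub_apply, Pi.sub_apply, slM_apply]
  change slM fX fD fE i j 1 0 - _ = _
  simp [slM_apply]

theorem tau_omegaElt {n : ℕ} (k : Fin n) :
    tau n ⟨omegaElt k, omegaElt_mem k⟩ = gammaElt k := by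
  change psiUS n (omegaElt k) 1 0 = _
  simp only [omegaElt, map_sub, map_add, map_sum, map_mul, Module.End.mul_apply, psiUS_e0_inv_one,
    psiUS_e0_one, psiUS_h, psiUS_root, psiUS_eOrH, LinearMap.add_apply, LinearMap.sum_apply,
    LinearMap.sub_apply, Pi.add_apply, Finset.sum_apply, map_one, Module.End.one_apply,
    slM_apply, Pi.sub_apply]
  have : slImg fX fD fE k.succ 0 (1 : FMod n) 0 = 0 := by
    change (∑ q, fX q * fE k q + fX k * slC fX fD fE : FEnd n) 1 0 = 0
    simp [LinearMap.sum_apply, fX]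
  rw [this]
  simp [gammaElt]


/-! ### Induced modules -/

theorem slUS_smul {n : ℕ} (c : ℂ) (y : sl n) : slUS (c • y) = c • slUS y := by
  rw [slUS, map_smul, map_smul]; rfl

section Induced
variable {n : ℕ} {N : Type*} [AddCommGroup N] [Module ℂ N]

/-- The `U_S`-submodule of `U_S ⊗_ℂ N` generated by the balancing relations `w ⊗ v - 1 ⊗ w v`, `w ∈ W`,
and `h_i ⊗ v - 1 ⊗ μ_i v`, `1 ≤ i ≤ n`. -/
def indRel (μ : Fin n → ℂ) (π : algW n →ₐ[ℂ] Module.End ℂ N) :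
    Submodule (US n) (US n ⊗[ℂ] N) :=
  Submodule.span (US n)
    ({t | ∃ (w : algW n) (v : N), t = (w : US n) ⊗ₜ v - 1 ⊗ₜ π w v} ∪
      {t | ∃ (i : Fin n) (v : N), t = slUS (hElt i.succ) ⊗ₜ v - 1 ⊗ₜ (μ i • v)})

/-- The induced module `G_μ(N) = U_S ⊗_{U(𝔥_n) W} N`, where `W` acts on `N` by `π` and `h_i` acts on `N`
by the scalar `μ_i`. The tensor product over the subalgebra `U(𝔥_n) W`, which is generated by `W` and
the `h_i`, is the quotient of `U_S ⊗_ℂ N` by the balancing relations of these generators. -/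
def GMod (μ : Fin n → ℂ) (π : algW n →ₐ[ℂ] Module.End ℂ N) : Type _ :=
  (US n ⊗[ℂ] N) ⧸ indRel μ π

variable (μ : Fin n → ℂ) (π : algW n →ₐ[ℂ] Module.End ℂ N)

instance : AddCommGroup (GMod μ π) := inferInstanceAs (AddCommGroup ((US n ⊗[ℂ] N) ⧸ indRel μ π))

instance : Module (US n) (GMod μ π) := inferInstanceAs (Module (US n) ((US n ⊗[ℂ] N) ⧸ indRel μ π))

instance : Module ℂ (GMod μ π) := inferInstanceAs (Module ℂ ((US n ⊗[ℂ] N) ⧸ indRel μ π))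

instance : IsScalarTower ℂ (US n) (GMod μ π) :=
  inferInstanceAs (IsScalarTower ℂ (US n) ((US n ⊗[ℂ] N) ⧸ indRel μ π))

instance : SMulCommClass ℂ (US n) (GMod μ π) := IsScalarTower.to_smulCommClass

/-- `sl_{n+1}` acts on `G_μ(N)` through `sl_{n+1} → U(sl_{n+1}) → U_S`. -/
instance : LieRingModule (sl n) (GMod μ π) where
  bracket y m := slUS y • m
  add_lie y z m := by
    change slUS (y + z) • m = slUS y • m + slUS z • m
    rw [slUS_add, add_smul]
  lie_add y m m' := smul_add (slUS y) m m'
  leibniz_lie y z m := by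
    change slUS y • slUS z • m = slUS ⁅y, z⁆ • m + slUS z • slUS y • m
    rw [slUS_lie, sub_smul, mul_smul, mul_smul, sub_add_cancel]

instance : LieModule ℂ (sl n) (GMod μ π) where
  smul_lie c y m := by
    change slUS (c • y) • m = c • slUS y • m
    rw [slUS_smul, smul_assoc]
  lie_smul c y m := smul_comm (slUS y) c m

end Induced

/-- The `W`-module `V^τ` of a `gl_n`-module `V`: the element `w ∈ W` acts as `τ(w) ∈ U(gl_n)`. -/
def tauRep {n : ℕ} (V : Type*) [AddCommGroup V] [Module ℂ V] [LieRingModule (gl n) V]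
    [LieModule ℂ (gl n) V] : algW n →ₐ[ℂ] Module.End ℂ V :=
  (UniversalEnvelopingAlgebra.lift ℂ (LieModule.toEnd ℂ (gl n) V)).comp (tau n)

/-! ### Weight modules and cuspidal modules -/

/-- The weight space `M_α` of all `v ∈ M` such that `h_i v = α_i v` for `1 ≤ i ≤ n`. -/
def weightSpace {n : ℕ} (M : Type*) [AddCommGroup M] [Module ℂ M] [LieRingModule (sl n) M]
    [LieModule ℂ (sl n) M] (α : Fin n → ℂ) : Submodule ℂ M where
  carrier := {v | ∀ i : Fin n, ⁅(hElt i.succ : sl n), v⁆ = α i • v}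
  add_mem' ha hb i := by rw [lie_add, ha i, hb i, smul_add]
  zero_mem' i := by rw [lie_zero, smul_zero]
  smul_mem' c v hv i := by rw [lie_smul, hv i, smul_comm]

/-- An `sl_{n+1}`-module is cuspidal if it is the direct sum of its weight spaces, all weight spaces are
finite-dimensional, and every root vector `e_{ij}`, `0 ≤ i ≠ j ≤ n`, acts injectively. -/
structure IsCuspidal (n : ℕ) (M : Type*) [AddCommGroup M] [Module ℂ M] [LieRingModule (sl n) M]
    [LieModule ℂ (sl n) M] : Prop where
  isInternal : DirectSum.IsInternal fun α : Fin n → ℂ => weightSpace M α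
  finite : ∀ α : Fin n → ℂ, FiniteDimensional ℂ (weightSpace M α)
  injective : ∀ (i j : Fin (n + 1)) (h : i ≠ j),
    Function.Injective fun v : M => ⁅rootVec i j h, v⁆

/-- `lam` is a highest weight of the `gl_n`-module `V`: there is a nonzero vector that is annihilated by
all `e_{ij}` with `i < j` and on which every `e_{ii}` acts as the scalar `lam i`. -/
def HasHighestWeight {n : ℕ} (V : Type*) [AddCommGroup V] [Module ℂ V] [LieRingModule (gl n) V]
    [LieModule ℂ (gl n) V] (lam : Fin n → ℂ) : Prop :=
  ∃ v : V, v ≠ 0 ∧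
    (∀ i j : Fin n, i < j → ⁅(Matrix.single i j (1 : ℂ) : gl n), v⁆ = 0) ∧
    ∀ i : Fin n, ⁅(Matrix.single i i (1 : ℂ) : gl n), v⁆ = lam i • v

end

end CuspidalGL

namespace CuspidalGL

noncomputable section

/-! ### Generators of `U_S` -/

/-! Write `e^r` for the monomial `e_{01}^{r_1} ⋯ e_{0n}^{r_n}`, `r ∈ ℤ^n`. The proof rests on the
decomposition `G_μ(V^τ) = ⊕_r e^r ⊗ V`, in which `e^r ⊗ V` has weight `μ - r` and is a copy of `V`.
So the module is always a weight module with finite-dimensional weight spaces, and only the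
injectivity of the root vectors is at stake.

Spanning (`GMod.span_mon`) holds because `U_S` is generated by `W`, the `h_i` and the `e_{0k}^{±1}`:
the definitions of `x_{ij}` and `ω_k` can be solved for `e_{ij}` and `e_{k0}`. Independence
(`IsWeightBasis.monSum_injective`) needs a module in which the monomials are visibly independent.
This is `KMod n V`, functions on `ℂ^n` with values in `V`, where `e_{0k}` acts as a shift and `W`
acts on constant functions through `τ` (`kRep_algW_const`). The function belonging to `1 ⊗ v` is the
weight `μ` part of the constant function `v`. In coordinates with respect to a weight basis of `V`
it is supported at single points, and different monomials move these points to different places. All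
of `ℂ^n` is used because the points `μ - wt p` need not be integral.

The `e_{0k}` are invertible, so each other root vector may be multiplied by a unit that makes it
preserve every `e^r ⊗ V`. With `a = μ - r`, the element `e_{ij} e_{0i} e_{0j}⁻¹` acts there as
`e_{ij} - e_{ii} + a_i`. The element `e_{k0} e_{0k}` acts as a combination of the `e_{kj}` with `j ≠
k`, plus an operator diagonal in the weight basis. As `e_{kj}` raises the `k`-th weight by one, both
operators are triangular, with diagonal entries `a_i - wt_i` and `(wt_k - a_k)(wt_k + |a| - 1)`
(`IsWeightBasis.rootOp_injective_iff`, `IsWeightBasis.rootZeroOp_injective_iff`). The weights of `V`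
lie in `λ + ℤ^n` and `r` runs over `ℤ^n`, so none of these entries vanishes exactly when the stated
numbers are not integers. -/

theorem subalgebra_US_eq_top {n : ℕ} (T : Subalgebra ℂ (US n)) (h1 : ∀ y : sl n, slUS y ∈ T)
    (h2 : ∀ k : Fin n, ((e0Unit k)⁻¹ : (US n)ˣ).val ∈ T) : T = ⊤ := by
  have hU : ∀ v : USl n, toUS n v ∈ T := fun v => by
    have : T.comap (toUS n) = ⊤ := ueaSubalgebra_eq_top _ h1
    exact (this ▸ Algebra.mem_top : v ∈ T.comap (toUS n))
  -- Each denominator has a left inverse in `T`, so a fraction can be rewritten as a product of two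
  -- elements of `T`.
  have hS : ∀ s : USl n, s ∈ oreS n → ∃ t ∈ T, t * toUS n s = 1 := fun s hs => by
    induction hs using Submonoid.closure_induction with
    | mem s hs =>
      obtain ⟨k, rfl⟩ := hs
      exact ⟨_, h2 k, Units.inv_mul (e0Unit k)⟩
    | one => exact ⟨1, one_mem _, by simp⟩
    | mul a b _ _ iha ihb =>
      obtain ⟨u, hu, h3⟩ := iha
      obtain ⟨v, hv, h4⟩ := ihb
      refine ⟨v * u, mul_mem hv hu, ?_⟩
      rw [map_mul, mul_assoc, ← mul_assoc u, h3, one_mul, h4]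
  refine eq_top_iff.2 fun u _ => ?_
  induction u using OreLocalization.ind with
  | _ r s =>
    obtain ⟨t, ht, h3⟩ := hS s s.2
    have h4 : toUS n s * (r /ₒ s) = toUS n r := OreLocalization.mul_cancel
    have h5 : r /ₒ s = t * toUS n r := by rw [← h4, ← mul_assoc, h3, one_mul]
    rw [h5]
    exact mul_mem ht (hU r)

/-- The endomorphisms that preserve a submodule. -/
def preserving {M : Type*} [AddCommGroup M] [Module ℂ M] (p : Submodule ℂ M) :
    Subalgebra ℂ (Module.End ℂ M) where
  carrier := {A | ∀ m ∈ p, A m ∈ p}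
  mul_mem' ha hb m hm := ha _ (hb m hm)
  add_mem' ha hb m hm := add_mem (ha m hm) (hb m hm)
  algebraMap_mem' c _ hm := p.smul_mem c hm

/-! ### Representations of `U_S` from the Weyl algebra relations -/

section WeylRep
variable {n : ℕ} {R : Type*} [Ring R] [Algebra ℂ R] {x D : Fin n → R} {E : Fin n → Fin n → R}

theorem slImg_mem (T : Subalgebra ℂ R) (hx : ∀ i, x i ∈ T) (hD : ∀ i, D i ∈ T)
    (hE : ∀ i j, E i j ∈ T) (i j : Fin (n + 1)) : slImg x D E i j ∈ T := by
  have hM : ∀ i j, slM x D E i j ∈ T := fun i j => add_mem (hE i j) (mul_mem (hx i) (hD j))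
  have hC : slC x D E ∈ T := sum_mem fun k _ => hM k k
  cases i using Fin.cases with
  | zero =>
    cases j using Fin.cases with
    | zero => exact neg_mem hC
    | succ j => exact neg_mem (hD j)
  | succ i =>
    cases j using Fin.cases with
    | zero => exact add_mem (sum_mem fun q _ => mul_mem (hx q) (hE i q)) (mul_mem (hx i) hC)
    | succ j => exact hM i j

/-- The formulas are ring expressions, hence hold componentwise. A relation between two
representations can therefore be treated as one invariant subspace of their product. -/
theorem slImg_prod {R' : Type*} [Ring R'] (x' D' : Fin n → R') (E' : Fin n → Fin n → R')
    (i j : Fin (n + 1)) :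
    slImg (fun i => (x i, x' i)) (fun i => (D i, D' i)) (fun i j => (E i j, E' i j)) i j =
      (slImg x D E i j, slImg x' D' E' i j) := by
  have hM : ∀ i j, slM (fun i => (x i, x' i)) (fun i => (D i, D' i)) (fun i j => (E i j, E' i j)) i j
      = (slM x D E i j, slM x' D' E' i j) := fun _ _ => rfl
  have hC : slC (fun i => (x i, x' i)) (fun i => (D i, D' i)) (fun i j => (E i j, E' i j))
      = (slC x D E, slC x' D' E') := by
    simp only [slC, hM]
    exact Prod.ext Prod.fst_sum Prod.snd_sum
  cases i using Fin.cases with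
  | zero =>
    cases j using Fin.cases with
    | zero => exact congrArg Neg.neg hC
    | succ j => rfl
  | succ i =>
    cases j using Fin.cases with
    | zero =>
      change ∑ q, _ + _ * slC _ _ _ = (∑ q, _ + _ * slC _ _ _, ∑ q, _ + _ * slC _ _ _)
      rw [hC]
      ext <;> simp [Prod.fst_sum, Prod.snd_sum]
    | succ j => rfl

variable (x D E) in
/-- The linear extension of `slImg` to all of `gl_{n+1}`. -/
def weylLin : Matrix (Fin (n + 1)) (Fin (n + 1)) ℂ →ₗ[ℂ] R where
  toFun Y := ∑ i, ∑ j, Y i j • slImg x D E i j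
  map_add' Y Z := by simp [add_smul, Finset.sum_add_distrib]
  map_smul' c Y := by simp [mul_smul, Finset.smul_sum]

theorem weylLin_single (i j : Fin (n + 1)) (c : ℂ) :
    weylLin x D E (Matrix.single i j c) = c • slImg x D E i j := by
  change ∑ k, ∑ l, (Matrix.single i j c) k l • slImg x D E k l = _
  simp [Matrix.single_apply, ite_and, ite_smul]

/-- Reduces the invariance of a subspace under all of `sl_{n+1}` to invariance under the operators
`x`, `D` and `E`. -/
theorem weylLin_mem (T : Subalgebra ℂ R) (hx : ∀ i, x i ∈ T) (hD : ∀ i, D i ∈ T)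
    (hE : ∀ i j, E i j ∈ T) (Y : Matrix (Fin (n + 1)) (Fin (n + 1)) ℂ) : weylLin x D E Y ∈ T := by
  change ∑ i, ∑ j, Y i j • slImg x D E i j ∈ T
  exact sum_mem fun i _ => sum_mem fun j _ => T.smul_mem (slImg_mem T hx hD hE i j) _

theorem weylLin_one : weylLin x D E 1 = 0 := by
  change ∑ i, ∑ j, (1 : Matrix (Fin (n + 1)) (Fin (n + 1)) ℂ) i j • slImg x D E i j = _
  simp only [Matrix.one_apply, ite_smul, one_smul, zero_smul, Finset.sum_ite_eq, Finset.mem_univ,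
    if_true]
  rw [Fin.sum_univ_succ]
  exact neg_add_cancel _

theorem weylLin_lie (H : WeylGl x D E) (Y Z : Matrix (Fin (n + 1)) (Fin (n + 1)) ℂ) :
    weylLin x D E ⁅Y, Z⁆ = ⁅weylLin x D E Y, weylLin x D E Z⁆ := by
  induction Y using Matrix.induction_on' with
  | h_zero => simp
  | h_add p q hp hq => rw [add_lie, map_add, map_add, add_lie, hp, hq]
  | h_std_basis i j a =>
    induction Z using Matrix.induction_on' with
    | h_zero => simp
    | h_add p q hp hq => rw [lie_add, map_add, map_add, lie_add, hp, hq]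
    | h_std_basis k l b =>
      have hs : ∀ X Y : R, ⁅a • X, b • Y⁆ = (a * b) • ⁅X, Y⁆ := fun X Y => by
        simp [Ring.lie_def, smul_sub, smul_smul, mul_comm b a]
      rw [weylLin_single, weylLin_single, hs, lie_slImg H, Ring.lie_def, map_sub]
      by_cases h1 : j = k <;> by_cases h2 : l = i <;>
        simp [h1, h2, Matrix.single_mul_single_of_ne, Matrix.single_mul_single_same, weylLin_single,
          mul_comm b a, smul_sub]

/-- The homomorphism `U(sl_{n+1}) → R` given by elements satisfying the relations `WeylGl`. -/
def weylU (H : WeylGl x D E) : USl n →ₐ[ℂ] R :=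
  UniversalEnvelopingAlgebra.lift ℂ
    { toLinearMap := (weylLin x D E).comp (sl n).subtype
      map_lie' := fun {Y Z} => weylLin_lie H Y.1 Z.1 }

theorem weylU_ι (H : WeylGl x D E) (y : sl n) :
    weylU H (UniversalEnvelopingAlgebra.ι ℂ y) = weylLin x D E y.1 := by
  rw [weylU, UniversalEnvelopingAlgebra.lift_ι_apply]; rfl

theorem weylU_e0 (H : WeylGl x D E) (k : Fin n) : weylU H (e0 k) = -D k := by
  rw [e0, weylU_ι]
  change weylLin x D E (Matrix.single _ _ _) = _
  rw [weylLin_single, one_smul]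
  rfl

theorem weylU_isUnit (H : WeylGl x D E) (hD : ∀ k, IsUnit (-D k)) (s : oreS n) :
    IsUnit (weylU H s) := by
  obtain ⟨s, hs⟩ := s
  change IsUnit (weylU H s)
  induction hs using Submonoid.closure_induction with
  | mem s hs =>
    obtain ⟨k, rfl⟩ := hs
    rw [weylU_e0]
    exact hD k
  | one => rw [map_one]; exact isUnit_one
  | mul a b _ _ iha ihb => rw [map_mul]; exact iha.mul ihb

/-- The homomorphism `U_S → R` given by elements satisfying the relations `WeylGl`, the `D k` being
invertible. -/
def weylUS (H : WeylGl x D E) (hD : ∀ k, IsUnit (-D k)) : US n →ₐ[ℂ] R where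
  __ := OreLocalization.universalHom (weylU H).toRingHom
    { toFun := fun s => (weylU_isUnit H hD s).unit
      map_one' := Units.ext (map_one (weylU H))
      map_mul' := fun s t => Units.ext (map_mul (weylU H) s.1 t.1) } (fun _ => rfl)
  commutes' r := (OreLocalization.universalHom_commutes (weylU H).toRingHom _
    (fun _ => rfl)).trans ((weylU H).commutes r)

theorem weylUS_toUS (H : WeylGl x D E) (hD : ∀ k, IsUnit (-D k)) (u : USl n) :
    weylUS H hD (toUS n u) = weylU H u :=
  OreLocalization.universalHom_commutes (weylU H).toRingHom _ (fun _ => rfl)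

theorem weylUS_slUS (H : WeylGl x D E) (hD : ∀ k, IsUnit (-D k)) (y : sl n) :
    weylUS H hD (slUS y) = weylLin x D E y.1 :=
  (weylUS_toUS H hD _).trans (weylU_ι H y)

theorem weylUS_e0Unit (H : WeylGl x D E) (hD : ∀ k, IsUnit (-D k)) (k : Fin n) :
    weylUS H hD (e0Unit k) = -D k :=
  (weylUS_toUS H hD _).trans (weylU_e0 H k)

theorem weylUS_h (H : WeylGl x D E) (hD : ∀ k, IsUnit (-D k)) (i : Fin n) :
    weylUS H hD (slUS (hElt i.succ)) = slM x D E i i := by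
  rw [weylUS_slUS]
  change weylLin x D E (_ - _ • _) = _
  rw [map_sub, map_smul, weylLin_one, smul_zero, sub_zero, weylLin_single, one_smul]
  rfl

end WeylRep

/-! ### Functions on `ℂ^n` with values in a `gl_n`-module -/

section Functions
variable {n : ℕ} {V : Type*} [AddCommGroup V] [Module ℂ V] [LieRingModule (gl n) V]
  [LieModule ℂ (gl n) V]

/-- Functions on `ℂ^n` with values in `V`. -/
abbrev KMod (n : ℕ) (V : Type*) : Type _ := (Fin n → ℂ) → V

variable (V) in
/-- The operator `(x_i f)(c) = -c_i f(c - ε_i)`. -/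
def kX (i : Fin n) : Module.End ℂ (KMod n V) where
  toFun f c := -(c i) • f (c - Pi.single i 1)
  map_add' f g := by ext c; simp
  map_smul' a f := by ext c; simp [smul_comm a]

variable (V) in
/-- The operator `(D_i f)(c) = -f(c + ε_i)`. -/
def kD (i : Fin n) : Module.End ℂ (KMod n V) where
  toFun f c := -f (c + Pi.single i 1)
  map_add' f g := by ext c; simp [add_comm]
  map_smul' a f := by ext c; simp

variable (V) in
/-- The pointwise action of `e_{ij}`. -/
def kE (i j : Fin n) : Module.End ℂ (KMod n V) where
  toFun f c := ⁅(Matrix.single i j (1 : ℂ) : gl n), f c⁆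
  map_add' f g := by ext c; simp
  map_smul' a f := by ext c; simp

theorem gl_lie (i j k l : Fin n) :
    ⁅(Matrix.single i j (1 : ℂ) : gl n), (Matrix.single k l (1 : ℂ) : gl n)⁆ =
    (if j = k then Matrix.single i l (1 : ℂ) else 0) -
      (if l = i then Matrix.single k j (1 : ℂ) else 0) := by
  rw [Ring.lie_def]
  by_cases h1 : j = k <;> by_cases h2 : l = i <;>
    simp [h1, h2, Matrix.single_mul_single_of_ne, Matrix.single_mul_single_same]

theorem gl_lie_lie (i j k l : Fin n) (v : V) :
    ⁅(Matrix.single i j (1 : ℂ) : gl n), ⁅(Matrix.single k l (1 : ℂ) : gl n), v⁆⁆ =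
    ⁅(Matrix.single k l (1 : ℂ) : gl n), ⁅(Matrix.single i j (1 : ℂ) : gl n), v⁆⁆ +
    ((if j = k then ⁅(Matrix.single i l (1 : ℂ) : gl n), v⁆ else 0) -
      (if l = i then ⁅(Matrix.single k j (1 : ℂ) : gl n), v⁆ else 0)) := by
  rw [leibniz_lie, gl_lie, sub_lie, add_comm]
  split_ifs <;> simp

variable (n V) in
theorem weylGl_k : WeylGl (kX (n := n) V) (kD V) (kE V) := by
  refine ⟨?_, ?_, ?_, ?_, ?_, ?_⟩
  · intro i j
    ext f c
    by_cases h : i = j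
    · subst h; rfl
    · have h1 : ((Pi.single i 1 : Fin n → ℂ)) j = 0 := by simp [Ne.symm h]
      have h2 : ((Pi.single j 1 : Fin n → ℂ)) i = 0 := by simp [h]
      simp [kX, h1, h2, smul_smul, mul_comm, sub_right_comm]
  · intro i j
    ext f c
    simp [kD, add_right_comm]
  · intro i j
    ext f c
    by_cases h : i = j
    · subst h
      simp [kD, kX, add_smul]
    · have h2 : ((Pi.single i 1 : Fin n → ℂ)) j = 0 := by simp [Ne.symm h]
      simp [kD, kX, h, add_sub_right_comm]
  · intro i j k
    ext f c
    simp [kE, kX]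
  · intro i j k
    ext f c
    simp [kE, kD]
  · intro i j k l
    ext f c
    rw [Ring.lie_def, LinearMap.sub_apply, Pi.sub_apply, Module.End.mul_apply, Module.End.mul_apply]
    simp only [kE, LinearMap.coe_mk, AddHom.coe_mk]
    rw [gl_lie_lie, add_sub_cancel_left]
    split_ifs <;> rfl

theorem isUnit_kD (k : Fin n) : IsUnit (-kD V k) := by
  rw [Module.End.isUnit_iff]
  refine ⟨fun f g h => ?_, fun f => ⟨fun c => f (c - Pi.single k 1), ?_⟩⟩
  · ext c
    have h1 := congrFun h (c - Pi.single k 1)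
    simpa [kD] using h1
  · ext c
    simp [kD]

variable (n V) in
/-- The representation of `U_S` on `KMod n V`. -/
def kRep : US n →ₐ[ℂ] Module.End ℂ (KMod n V) := weylUS (weylGl_k n V) isUnit_kD

theorem kRep_e0Unit (k : Fin n) (f : KMod n V) (c : Fin n → ℂ) :
    kRep n V (e0Unit k) f c = f (c + Pi.single k 1) := by
  rw [kRep, weylUS_e0Unit]; simp [kD]

theorem kRep_e0Unit_inv (k : Fin n) (f : KMod n V) (c : Fin n → ℂ) :
    kRep n V ((e0Unit k)⁻¹ : (US n)ˣ).val f c = f (c - Pi.single k 1) := by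
  have h : kRep n V (e0Unit k) (kRep n V ((e0Unit k)⁻¹ : (US n)ˣ).val f) = f := by
    rw [← Module.End.mul_apply, ← map_mul, Units.mul_inv, map_one, Module.End.one_apply]
  rw [← congrFun h (c - Pi.single k 1), kRep_e0Unit, sub_add_cancel]

/-- The shifts in `x_k` and `D_k` cancel, so `h_k` acts pointwise. A vector of weight `ν` placed at
the point `c` thus has weight `ν + c`. -/
theorem kRep_h (k : Fin n) (f : KMod n V) (c : Fin n → ℂ) :
    kRep n V (slUS (hElt k.succ)) f c
      = ⁅(Matrix.single k k (1 : ℂ) : gl n), f c⁆ + c k • f c := by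
  rw [kRep, weylUS_h]; simp [slM, kE, kX, kD]

variable (n V) in
/-- The functions that are polynomial along every coordinate line. -/
def linePoly : Submodule ℂ (KMod n V) where
  carrier := {f | ∀ (φ : Module.Dual ℂ V) (c : Fin n → ℂ) (k : Fin n),
    ∃ p : Polynomial ℂ, ∀ t : ℂ, φ (f (c + Pi.single k t)) = p.eval t}
  add_mem' hf hg φ c k := by
    obtain ⟨p, hp⟩ := hf φ c k
    obtain ⟨q, hq⟩ := hg φ c k
    exact ⟨p + q, fun t => by simp [hp, hq]⟩
  zero_mem' φ c k := ⟨0, by simp⟩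
  smul_mem' a f hf φ c k := by
    obtain ⟨p, hp⟩ := hf φ c k
    exact ⟨a • p, fun t => by simp [hp]⟩

/-- Shifts and the pointwise action of `gl_n` keep polynomiality along lines, and `x_i` only adds a
linear factor. Constant functions therefore stay polynomial along lines under all of `U_S`. -/
theorem kRep_linePoly (u : US n) : kRep n V u ∈ preserving (linePoly n V) := by
  have hshift : ∀ (a : Fin n → ℂ) (f : KMod n V), f ∈ linePoly n V →
      (fun c => f (c + a)) ∈ linePoly n V := fun a f hf φ c k => by
    obtain ⟨p, hp⟩ := hf φ (c + a) k
    exact ⟨p, fun t => by rw [← hp, add_right_comm]⟩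
  suffices h : (preserving (linePoly n V)).comap (kRep n V) = ⊤ from
    (h ▸ Algebra.mem_top : u ∈ (preserving (linePoly n V)).comap (kRep n V))
  refine subalgebra_US_eq_top _ (fun y => ?_) fun k f hf => ?_
  · rw [Subalgebra.mem_comap, kRep, weylUS_slUS]
    refine weylLin_mem _ (fun i f hf φ c k => ?_) (fun i f hf => ?_) (fun i j f hf φ c k => ?_) _
    · obtain ⟨p, hp⟩ := hshift (-Pi.single i 1) f hf φ c k
      -- Along the `k`-th line through `c` the coordinate `c_i` becomes `c_i + t` if `i = k` and is
      -- unchanged otherwise.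
      refine ⟨-(Polynomial.C (c i) + if i = k then Polynomial.X else 0) * p, fun t => ?_⟩
      have h := hp t
      simp only [← sub_eq_add_neg] at h
      by_cases hik : i = k
      · subst hik; simp [kX, h]; ring
      · simp [kX, h, hik]
    · exact neg_mem (hshift (Pi.single i 1) f hf)
    · exact hf (φ.comp (LieModule.toEnd ℂ (gl n) V (Matrix.single i j (1 : ℂ)))) c k
  · have h := hshift (-Pi.single k 1) f hf
    have e : kRep n V ((e0Unit k)⁻¹ : (US n)ˣ).val f = fun c => f (c + -Pi.single k 1) := by
      ext c; rw [kRep_e0Unit_inv, sub_eq_add_neg]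
    change kRep n V ((e0Unit k)⁻¹ : (US n)ˣ).val f ∈ linePoly n V
    rwa [e]

/-! ### Comparison with `τ`: the action of `W` on constant functions -/

variable (n V) in
/-- The action of `U(gl_n)` on `V`. -/
def actU : UGl n →ₐ[ℂ] Module.End ℂ V :=
  UniversalEnvelopingAlgebra.lift ℂ (LieModule.toEnd ℂ (gl n) V)

theorem actU_glU (i j : Fin n) (v : V) :
    actU n V (glU i j) v = ⁅(Matrix.single i j (1 : ℂ) : gl n), v⁆ := by
  rw [actU, glU, UniversalEnvelopingAlgebra.lift_ι_apply]; rfl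

/-- The pairs of functions on `ℂ^n` and `ℤ^n` that correspond to each other by restriction to `ℤ^n` and
evaluation at `v`. -/
def evalRel (v : V) : Submodule ℂ (KMod n V × FMod n) where
  carrier := {p | ∀ r : Fin n → ℤ, p.1 (fun k => (r k : ℂ)) = actU n V (p.2 r) v}
  add_mem' hf hg r := by simp [hf r, hg r]
  zero_mem' r := by simp
  smul_mem' a f hf r := by simp [hf r]

theorem weylLin_eq_psiLin : weylLin fX fD fE = psiLin n := rfl

/-- Both modules are given by the same formulas in `x`, `D` and `E`, and these agree at integral
points. This transports the definition of `τ`, made with `FMod n`, to `KMod n V`. -/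
theorem kRep_evalRel (v : V) (u : US n) (f : KMod n V) (F : FMod n) (h : (f, F) ∈ evalRel v) :
    (kRep n V u f, psiUS n u F) ∈ evalRel v := by
  let ρ : US n →ₐ[ℂ] Module.End ℂ (KMod n V × FMod n) :=
    (LinearMap.prodMapAlgHom ℂ _ _).comp ((kRep n V).prod (psiUS n))
  suffices hT : (preserving (evalRel v)).comap ρ = ⊤ from
    (hT ▸ Algebra.mem_top : u ∈ (preserving (evalRel v)).comap ρ) _ h
  have hadd : ∀ (r : Fin n → ℤ) (k : Fin n), (fun j => (r j : ℂ)) + Pi.single k 1 =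
      fun j => (((r + Pi.single k 1 : Fin n → ℤ) j : ℤ) : ℂ) := fun r k => by
    ext j; simp [Pi.single_apply]
  have hsub : ∀ (r : Fin n → ℤ) (k : Fin n), (fun j => (r j : ℂ)) - Pi.single k 1 =
      fun j => (((r - Pi.single k 1 : Fin n → ℤ) j : ℤ) : ℂ) := fun r k => by
    ext j; simp [Pi.single_apply]
  refine subalgebra_US_eq_top _ (fun y => ?_) fun k p hp r => ?_
  · rw [Subalgebra.mem_comap]
    -- The pair of actions is again given by the Weyl algebra formulas, now in the product ring, so
    -- `weylLin_mem` applies to it.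
    have e : ρ (slUS y) = LinearMap.prodMapAlgHom ℂ _ _
        (weylLin (fun i => (kX V i, fX i)) (fun i => (kD V i, fD i))
          (fun i j => (kE V i j, fE i j)) y.1) := by
      change LinearMap.prodMapAlgHom ℂ _ _ (kRep n V (slUS y), psiUS n (slUS y)) = _
      congr 1
      rw [kRep, weylUS_slUS, psiUS_sl, ← weylLin_eq_psiLin]
      simp only [weylLin, LinearMap.coe_mk, AddHom.coe_mk, slImg_prod]
      ext1 <;> simp [Prod.fst_sum, Prod.snd_sum]
    rw [e]
    refine weylLin_mem ((preserving (evalRel (n := n) v)).comap (LinearMap.prodMapAlgHom ℂ _ _))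
      (fun i p hp r => ?_) (fun i p hp r => ?_) (fun i j p hp r => ?_) y.1
    · have := hp (r - Pi.single i 1)
      rw [← hsub] at this
      simp [kX, fX, this]
    · have := hp (r + Pi.single i 1)
      rw [← hadd] at this
      simp [kD, fD, this]
    · have := hp r
      simp [kE, fE, this, actU_glU]
  · have hF : psiUS n ((e0Unit k)⁻¹ : (US n)ˣ).val p.2 r = p.2 (r - Pi.single k 1) := by
      have h : psiUS n (e0Unit k) (psiUS n ((e0Unit k)⁻¹ : (US n)ˣ).val p.2) = p.2 := by
        rw [← Module.End.mul_apply, ← map_mul, Units.mul_inv, map_one, Module.End.one_apply]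
      conv_rhs => rw [← h, psiUS_e0Unit]
      simp [fD]
    change kRep n V ((e0Unit k)⁻¹ : (US n)ˣ).val p.1 _ =
      actU n V (psiUS n ((e0Unit k)⁻¹ : (US n)ˣ).val p.2 r) v
    rw [kRep_e0Unit_inv, hF, hsub]
    exact hp _

/-- Invariance under integral shifts alone leaves many functions on `ℂ^n`. A polynomial in one
variable with period one is constant, so polynomiality along lines excludes all but the constants.
-/
theorem linePoly_periodic (f : KMod n V) (hf : f ∈ linePoly n V)
    (h : ∀ (k : Fin n) (c : Fin n → ℂ), f (c + Pi.single k 1) = f c) (c : Fin n → ℂ) :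
    f c = f 0 := by
  have h1 : ∀ (k : Fin n) (t : ℂ) (c : Fin n → ℂ), f (c + Pi.single k t) = f c := fun k t c => by
    rw [← sub_eq_zero, ← Module.forall_dual_apply_eq_zero_iff ℂ]
    intro φ
    obtain ⟨p, hp⟩ := hf φ c k
    have h2 : ∀ m : ℕ, f (c + Pi.single k (m : ℂ)) = f c := fun m => by
      induction m with
      | zero => simp
      | succ m ih => rw [Nat.cast_succ, Pi.single_add, ← add_assoc, h, ih]
    -- The difference vanishes at all natural numbers, hence identically.
    have h3 : p - Polynomial.C (φ (f c)) = 0 := by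
      refine Polynomial.eq_zero_of_infinite_isRoot _
        ((Set.infinite_range_of_injective (Nat.cast_injective (R := ℂ))).mono ?_)
      rintro _ ⟨m, rfl⟩
      simp [← hp, h2]
    rw [map_sub, hp, sub_eq_zero.1 h3, Polynomial.eval_C, sub_self]
  have h2 : ∀ s : Finset (Fin n), f (∑ k ∈ s, Pi.single k (c k)) = f 0 := fun s => by
    induction s using Finset.induction_on with
    | empty => rfl
    | insert k s hk ih => rw [Finset.sum_insert hk, add_comm, h1, ih]
  rw [← h2 Finset.univ, Finset.univ_sum_single]

/-- `W` acts on constant functions through `τ`. -/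
theorem kRep_algW_const (w : algW n) (v : V) :
    kRep n V w (Function.const _ v) = Function.const _ (tauRep V w v) := by
  obtain ⟨-, hw⟩ := (mem_algW_iff w.1).1 w.2
  ext c
  -- Since `w` commutes with the shifts `e_{0k}`, its value on a constant function is periodic and
  -- hence constant; the value at `0` is read off from `FMod n`.
  rw [linePoly_periodic (kRep n V w (Function.const _ v))]
  · have h : ((Function.const _ v : KMod n V), (1 : FMod n)) ∈ evalRel v := fun r => by simp
    have h1 := kRep_evalRel v w.1 _ _ h 0
    simp only [Pi.zero_apply, Int.cast_zero] at h1
    exact h1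
  · exact kRep_linePoly w.1 _ fun φ c k => ⟨Polynomial.C (φ v), by simp⟩
  · intro k c
    have e : kRep n V (e0Unit k) (Function.const _ v) = Function.const _ v := by
      ext c; rw [kRep_e0Unit]; rfl
    rw [← kRep_e0Unit k (kRep n V w (Function.const _ v)), ← Module.End.mul_apply, ← map_mul,
      (hw k).eq, map_mul, Module.End.mul_apply, e]

end Functions

section WeightBasis
variable {n : ℕ} {V : Type*} [AddCommGroup V] [Module ℂ V] [LieRingModule (gl n) V]
  [LieModule ℂ (gl n) V]

/-! ### Bases of weight vectors -/

/-- The vectors of a weight in `lam + ℤ^n`. -/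
def integralWeightVectors (V : Type*) [AddCommGroup V] [Module ℂ V] [LieRingModule (gl n) V]
    (lam : Fin n → ℂ) : Set V :=
  {v | ∃ d : Fin n → ℤ, ∀ k, ⁅(Matrix.single k k (1 : ℂ) : gl n), v⁆ = (lam k + d k) • v}

theorem lie_mem_integralWeightVectors (lam : Fin n → ℂ) (i j : Fin n) (v : V)
    (hv : v ∈ integralWeightVectors V lam) :
    ⁅(Matrix.single i j (1 : ℂ) : gl n), v⁆ ∈ integralWeightVectors V lam := by
  obtain ⟨d, hd⟩ := hv
  refine ⟨d + Pi.single i 1 - Pi.single j 1, fun k => ?_⟩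
  rw [gl_lie_lie, hd, lie_smul]
  simp only [Pi.sub_apply, Pi.add_apply, Pi.single_apply, Int.cast_sub, Int.cast_add, Int.cast_ite,
    Int.cast_one, Int.cast_zero]
  by_cases h1 : k = i <;> by_cases h2 : j = k
  · subst h1 h2; simp
  · subst h1; simp [h2, Ne.symm h2, add_smul, ← add_assoc]
  · subst h2; simp [h1, add_smul, sub_smul]; abel
  · simp [h1, h2, Ne.symm h2]

/-- The matrix unit `e_{ij}` changes a weight by `ε_i - ε_j`, so the span is a `gl_n`-submodule. It
contains the highest weight vector, and irreducibility makes it everything. -/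
theorem span_integralWeightVectors [LieModule.IsIrreducible ℂ (gl n) V] (lam : Fin n → ℂ)
    (hlam : HasHighestWeight V lam) : Submodule.span ℂ (integralWeightVectors V lam) = ⊤ := by
  let S : LieSubmodule ℂ (gl n) V :=
    { Submodule.span ℂ (integralWeightVectors V lam) with
      lie_mem := by
        intro Y v hv
        change v ∈ Submodule.span ℂ (integralWeightVectors V lam) at hv
        change ⁅Y, v⁆ ∈ Submodule.span ℂ (integralWeightVectors V lam)
        induction Y using Matrix.induction_on' with
        | h_zero => rw [zero_lie]; exact zero_mem _
        | h_add p q hp hq => rw [add_lie]; exact add_mem hp hq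
        | h_std_basis i j a =>
          have e : (Matrix.single i j a : gl n) = a • Matrix.single i j (1 : ℂ) := by simp
          rw [e, smul_lie]
          refine Submodule.smul_mem _ _ ?_
          induction hv using Submodule.span_induction with
          | mem v hv => exact Submodule.subset_span (lie_mem_integralWeightVectors lam i j v hv)
          | zero => rw [lie_zero]; exact zero_mem _
          | add v w _ _ hv hw => rw [lie_add]; exact add_mem hv hw
          | smul a v _ hv => rw [lie_smul]; exact Submodule.smul_mem _ _ hv }
  obtain ⟨v, hv0, -, hv⟩ := hlam
  have hvS : v ∈ S := Submodule.subset_span ⟨0, fun k => by simpa using hv k⟩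
  rcases eq_bot_or_eq_top S with h | h
  · rw [h, LieSubmodule.mem_bot] at hvS
    exact absurd hvS hv0
  · exact congrArg LieSubmodule.toSubmodule h

/-- A basis of weight vectors, of weights `wt p`. -/
def IsWeightBasis {ι : Type*} (b : Module.Basis ι ℂ V) (wt : ι → Fin n → ℂ) : Prop :=
  ∀ p k, ⁅(Matrix.single k k (1 : ℂ) : gl n), b p⁆ = wt p k • b p

theorem exists_weightBasis [FiniteDimensional ℂ V] [LieModule.IsIrreducible ℂ (gl n) V]
    (lam : Fin n → ℂ) (hlam : HasHighestWeight V lam) :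
    ∃ (s : Set V) (_ : Fintype s) (b : Module.Basis s ℂ V) (d : s → Fin n → ℤ),
      IsWeightBasis b fun p k => lam k + d p k := by
  have h := (span_integralWeightVectors lam hlam).ge
  let b := Module.Basis.ofSpan h
  have hb : ∀ p, b p ∈ integralWeightVectors V lam := fun p =>
    Module.Basis.ofSpan_subset h ⟨p, rfl⟩
  choose d hd using hb
  exact ⟨_, FiniteDimensional.fintypeBasisIndex b, b, d, hd⟩

/-! ### Operators that are triangular for a weight basis -/

variable {ι : Type*} [Fintype ι] {b : Module.Basis ι ℂ V} {wt : ι → Fin n → ℂ}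

theorem IsWeightBasis.repr_lie (hb : IsWeightBasis b wt) (k : Fin n) (v : V) (p : ι) :
    b.repr ⁅(Matrix.single k k (1 : ℂ) : gl n), v⁆ p = wt p k * b.repr v p := by
  classical
  conv_lhs => rw [← b.sum_repr v]
  simp only [lie_sum, lie_smul, hb _ k, map_sum, map_smul, Finsupp.coe_finsetSum, Finset.sum_apply,
    Finsupp.smul_apply, Module.Basis.repr_self, Finsupp.single_apply, smul_eq_mul]
  rw [Finset.sum_eq_single p]
  · simp [mul_comm]
  · intro q _ hq; simp [hq]
  · simp

/-- Since `[e_{kk}, e_{kj}] = e_{kj}` for `j ≠ k`, the vector `e_{kj} b_p` has `k`-th weight one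
higher than `b_p`, and so do all basis vectors occurring in it. -/
theorem IsWeightBasis.repr_root (hb : IsWeightBasis b wt) {k j : Fin n} (hkj : j ≠ k) (p q : ι)
    (h : b.repr ⁅(Matrix.single k j (1 : ℂ) : gl n), b p⁆ q ≠ 0) : wt q k = wt p k + 1 := by
  have h1 := hb.repr_lie k ⁅(Matrix.single k j (1 : ℂ) : gl n), b p⁆ q
  rw [gl_lie_lie, hb p k, lie_smul] at h1
  simp only [if_true, if_neg hkj, sub_zero, map_add, map_smul, Finsupp.add_apply,
    Finsupp.smul_apply, smul_eq_mul] at h1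
  refine mul_right_cancel₀ h ?_
  rw [← h1]; ring

/-- Each `e_{kj}` with `j ≠ k` raises the `k`-th weight by one, so the matrix of `T` is triangular
for the grading by that weight, and `det T` is the product of the `t p`. The integral offsets `d`
supply the linear order, which complex weights lack. -/
theorem IsWeightBasis.injective_iff (hb : IsWeightBasis b wt) (k : Fin n) (lam : ℂ) (d : ι → ℤ)
    (hd : ∀ p, wt p k = lam + d p) (T : Module.End ℂ V) (t : ι → ℂ) (s : ι → Fin n → ℂ)
    (hT : ∀ p, T (b p) = t p • b p +
      ∑ j ∈ Finset.univ.erase k, s p j • ⁅(Matrix.single k j (1 : ℂ) : gl n), b p⁆) :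
    Function.Injective T ↔ ∀ p, t p ≠ 0 := by
  classical
  have : FiniteDimensional ℂ V := b.finiteDimensional_of_finite
  have hne : ∀ q p, q ≠ p → LinearMap.toMatrix b b T q p ≠ 0 → d q = d p + 1 := fun q p hqp h => by
    rw [LinearMap.toMatrix_apply, hT] at h
    simp only [map_add, map_sum, map_smul, Finsupp.add_apply, Finsupp.smul_apply,
      Module.Basis.repr_self, Finsupp.single_eq_of_ne hqp, smul_zero, zero_add,
      Finsupp.coe_finsetSum, Finset.sum_apply] at h
    obtain ⟨j, hj, h1⟩ := Finset.exists_ne_zero_of_sum_ne_zero h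
    have h2 := hb.repr_root (Finset.ne_of_mem_erase hj) p q (right_ne_zero_of_mul h1)
    rw [hd, hd, add_assoc, add_right_inj] at h2
    exact_mod_cast h2
  have hdiag : ∀ p, LinearMap.toMatrix b b T p p = t p := fun p => by
    rw [LinearMap.toMatrix_apply, hT]
    simp only [map_add, map_sum, map_smul, Finsupp.add_apply, Finsupp.smul_apply,
      Module.Basis.repr_self, Finsupp.single_eq_same, Finsupp.coe_finsetSum, Finset.sum_apply]
    rw [Finset.sum_eq_zero, add_zero, smul_eq_mul, mul_one]
    intro j hj
    by_contra h
    have := hb.repr_root (Finset.ne_of_mem_erase hj) p p (right_ne_zero_of_mul h)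
    simp at this
  -- The sign makes raising the weight agree with the convention of `BlockTriangular`, where entries
  -- below the diagonal blocks vanish.
  have hblock : (LinearMap.toMatrix b b T).BlockTriangular fun p => -d p := fun q p hqp => by
    by_contra h
    rcases eq_or_ne q p with rfl | hne'
    · exact lt_irrefl _ hqp
    · have := hne q p hne' h
      simp only at hqp
      omega
  have hdet : LinearMap.det T = ∏ a ∈ Finset.univ.image fun p => -d p,
      ∏ p : {p // -d p = a}, t p := by
    rw [← LinearMap.det_toMatrix b, hblock.det]
    refine Finset.prod_congr rfl fun a _ => ?_
    have : (LinearMap.toMatrix b b T).toSquareBlock (fun p => -d p) a =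
        Matrix.diagonal fun p : {p // -d p = a} => t p := by
      ext q p
      rcases eq_or_ne q p with rfl | h
      · rw [Matrix.diagonal_apply_eq]; exact hdiag _
      · rw [Matrix.diagonal_apply_ne _ h]
        by_contra h'
        have := hne q p (fun e => h (Subtype.ext e)) h'
        have h1 := q.2
        have h2 := p.2
        omega
    rw [this, Matrix.det_diagonal]
  rw [← LinearMap.ker_eq_bot, ← LinearMap.isUnit_iff_ker_eq_bot, LinearMap.isUnit_iff_isUnit_det,
    hdet, isUnit_iff_ne_zero]
  simp only [Finset.prod_ne_zero_iff]
  exact ⟨fun h p => h (-d p) (Finset.mem_image_of_mem _ (Finset.mem_univ p)) ⟨p, rfl⟩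
    (Finset.mem_univ _), fun h _ _ p _ => h p⟩

/-! ### The projection onto a weight space of `KMod n V` -/

variable (b wt) in
/-- The projection of `KMod n V` onto its subspace on which every `h_k` acts as `μ k`. -/
def weightProj (μ : Fin n → ℂ) : Module.End ℂ (KMod n V) := by
  classical
  exact
  { toFun := fun f c => b.equivFun.symm fun p => if wt p + c = μ then b.repr (f c) p else 0
    map_add' := fun f g => by
      ext c
      apply b.equivFun.injective
      ext p
      simp only [Pi.add_apply, map_add, LinearEquiv.apply_symm_apply, Finsupp.add_apply]
      split_ifs <;> simp
    map_smul' := fun a f => by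
      ext c
      apply b.equivFun.injective
      ext p
      simp only [Pi.smul_apply, map_smul, LinearEquiv.apply_symm_apply, Finsupp.smul_apply,
        RingHom.id_apply]
      split_ifs <;> simp }

theorem repr_weightProj (μ : Fin n → ℂ) (f : KMod n V) (c : Fin n → ℂ) (p : ι) [Decidable (wt p + c = μ)] :
    b.repr (weightProj b wt μ f c) p = if wt p + c = μ then b.repr (f c) p else 0 := by
  rw [← Module.Basis.equivFun_apply]
  simp only [weightProj, LinearMap.coe_mk, AddHom.coe_mk, LinearEquiv.apply_symm_apply]
  congr

theorem IsWeightBasis.repr_kRep_h (hb : IsWeightBasis b wt) (k : Fin n) (f : KMod n V)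
    (c : Fin n → ℂ) (p : ι) :
    b.repr (kRep n V (slUS (hElt k.succ)) f c) p = (wt p k + c k) * b.repr (f c) p := by
  rw [kRep_h, map_add, Finsupp.add_apply, hb.repr_lie, map_smul, Finsupp.smul_apply, smul_eq_mul,
    add_mul]

theorem KMod.ext_repr (b : Module.Basis ι ℂ V) {f g : KMod n V}
    (h : ∀ c p, b.repr (f c) p = b.repr (g c) p) : f = g :=
  funext fun c => b.ext_elem (h c)

theorem IsWeightBasis.kRep_h_weightProj (hb : IsWeightBasis b wt) (μ : Fin n → ℂ) (k : Fin n)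
    (f : KMod n V) :
    kRep n V (slUS (hElt k.succ)) (weightProj b wt μ f) = μ k • weightProj b wt μ f := by
  classical
  refine KMod.ext_repr b fun c p => ?_
  rw [hb.repr_kRep_h, Pi.smul_apply, map_smul, Finsupp.smul_apply, smul_eq_mul, repr_weightProj]
  split_ifs with h
  · rw [← h, Pi.add_apply]
  · simp

theorem IsWeightBasis.weightProj_of_h (hb : IsWeightBasis b wt) (μ : Fin n → ℂ) (f : KMod n V)
    (hf : ∀ k, kRep n V (slUS (hElt k.succ)) f = μ k • f) : weightProj b wt μ f = f := by
  classical
  refine KMod.ext_repr b fun c p => ?_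
  rw [repr_weightProj]
  split_ifs with h
  · rfl
  · obtain ⟨k, hk⟩ := Function.ne_iff.1 h
    have h1 := hb.repr_kRep_h k f c p
    rw [hf, Pi.smul_apply, map_smul, Finsupp.smul_apply, smul_eq_mul] at h1
    by_contra h2
    exact hk (mul_right_cancel₀ (Ne.symm h2) h1).symm

theorem IsWeightBasis.weightProj_h (hb : IsWeightBasis b wt) (μ : Fin n → ℂ) (k : Fin n)
    (f : KMod n V) :
    weightProj b wt μ (kRep n V (slUS (hElt k.succ)) f) = μ k • weightProj b wt μ f := by
  classical
  refine KMod.ext_repr b fun c p => ?_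
  rw [Pi.smul_apply, map_smul, Finsupp.smul_apply, smul_eq_mul, repr_weightProj, repr_weightProj,
    hb.repr_kRep_h]
  split_ifs with h
  · rw [← h, Pi.add_apply]
  · simp

/-- Coordinate `p` at the point `c` has weight `wt p + c`. If this differs from `μ`, it differs in
some `k`, and `h_k - μ_k` can be inverted on that coordinate. This describes the complement of the
weight space without infinite sums of weight vectors. -/
theorem IsWeightBasis.exists_sub_weightProj (hb : IsWeightBasis b wt) (μ : Fin n → ℂ)
    (f : KMod n V) : ∃ g : Fin n → KMod n V,
      f = weightProj b wt μ f + ∑ k, (kRep n V (slUS (hElt k.succ)) (g k) - μ k • g k) := by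
  classical
  have hch : ∀ (c : Fin n → ℂ) (p : ι), ∃ a : Fin n → ℂ,
      ∑ k, (wt p k + c k - μ k) * a k = if wt p + c = μ then 0 else 1 := fun c p => by
    split_ifs with h
    · exact ⟨0, by simp⟩
    · obtain ⟨k, hk⟩ := Function.ne_iff.1 h
      refine ⟨Pi.single k (wt p k + c k - μ k)⁻¹, ?_⟩
      rw [Finset.sum_eq_single k]
      · rw [Pi.single_eq_same]; exact mul_inv_cancel₀ (sub_ne_zero.2 hk)
      · intro j _ hj; simp [hj]
      · simp
  choose a ha using hch
  refine ⟨fun k c => b.equivFun.symm fun p => a c p k * b.repr (f c) p,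
    KMod.ext_repr b fun c p => ?_⟩
  have e : ∀ k, b.repr (b.equivFun.symm fun p => a c p k * b.repr (f c) p) p =
      a c p k * b.repr (f c) p := fun k => by
    rw [← Module.Basis.equivFun_apply, LinearEquiv.apply_symm_apply]
  simp only [Pi.add_apply, Finset.sum_apply, Pi.sub_apply, Pi.smul_apply, map_add, map_sum, map_sub,
    map_smul, Finsupp.add_apply, Finsupp.coe_finsetSum, Finsupp.sub_apply, Finsupp.smul_apply,
    hb.repr_kRep_h, smul_eq_mul, e, ← sub_mul, ← mul_assoc, ← Finset.sum_mul, ha, repr_weightProj]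
  split_ifs <;> simp

/-- Operators that commute with all `h_k` commute with the weight projection. -/
theorem IsWeightBasis.weightProj_comm (hb : IsWeightBasis b wt) (μ : Fin n → ℂ)
    (A : Module.End ℂ (KMod n V)) (hA : ∀ (k : Fin n) f, A (kRep n V (slUS (hElt k.succ)) f) =
      kRep n V (slUS (hElt k.succ)) (A f)) (f : KMod n V) :
    A (weightProj b wt μ f) = weightProj b wt μ (A f) := by
  obtain ⟨g, hg⟩ := hb.exists_sub_weightProj μ f
  have h := congrArg (fun f => weightProj b wt μ (A f)) hg
  -- The projection kills the image of `h_k - μ_k`, also after applying `A`, so only `A (weightProj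
  -- b wt μ f)` remains; it already has weight `μ`.
  simp only [map_add, map_sum, map_sub, map_smul, hA, hb.weightProj_h, sub_self,
    Finset.sum_const_zero, add_zero] at h
  rw [h, hb.weightProj_of_h μ (A (weightProj b wt μ f))]
  intro k
  rw [← hA, hb.kRep_h_weightProj, map_smul]

end WeightBasis

/-! ### Monomials in the `e_{0k}` -/

section Monomials
variable {n : ℕ}

theorem zpowersHom_e0_comm : Pairwise fun i j : Fin n => ∀ x y : Multiplicative ℤ,
    Commute (zpowersHom (US n)ˣ (e0Unit i) x) (zpowersHom (US n)ˣ (e0Unit j) y) := fun i j _ x y => by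
  rw [zpowersHom_apply, zpowersHom_apply]
  exact Commute.zpow_zpow (Commute.units_of_val (e0_comm i j)) _ _

/-- The monomial `e_{01}^{r_1} ⋯ e_{0n}^{r_n}`. -/
def e0Mon (r : Fin n → ℤ) : (US n)ˣ :=
  MonoidHom.noncommPiCoprod (fun k : Fin n => zpowersHom (US n)ˣ (e0Unit k)) zpowersHom_e0_comm
    fun k => Multiplicative.ofAdd (r k)

theorem e0Mon_zero : e0Mon (0 : Fin n → ℤ) = 1 :=
  map_one (MonoidHom.noncommPiCoprod (fun k : Fin n => zpowersHom (US n)ˣ (e0Unit k))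
    zpowersHom_e0_comm)

theorem e0Mon_single_add (k : Fin n) (r : Fin n → ℤ) :
    e0Mon (Pi.single k 1 + r) = e0Unit k * e0Mon r := by
  have h := map_mul (MonoidHom.noncommPiCoprod (fun k : Fin n => zpowersHom (US n)ˣ (e0Unit k))
    zpowersHom_e0_comm) (Pi.mulSingle k (Multiplicative.ofAdd 1))
    (fun j => Multiplicative.ofAdd (r j))
  rw [MonoidHom.noncommPiCoprod_mulSingle, zpowersHom_apply, toAdd_ofAdd, zpow_one] at h
  rw [e0Mon, e0Mon, ← h]
  congr 1

/-- An equivalence in the inductive step allows movement in both directions, so the invertible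
generators `e_{0k}` suffice and their inverses need no separate case. -/
theorem int_vec_induction {P : (Fin n → ℤ) → Prop} (h0 : P 0)
    (h : ∀ k r, P r ↔ P (Pi.single k 1 + r)) (r : Fin n → ℤ) : P r := by
  have h1 : ∀ (k : Fin n) (m : ℤ) (r : Fin n → ℤ), P r ↔ P (Pi.single k m + r) := fun k m => by
    induction m with
    | zero => simp
    | succ m ih =>
      intro r
      rw [ih, h k, ← add_assoc, ← Pi.single_add, add_comm 1]
    | pred m ih =>
      intro r
      have := h k ((Pi.single k (-(m : ℤ) - 1) : Fin n → ℤ) + r)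
      rw [ih, this, ← add_assoc, ← Pi.single_add, add_sub_cancel]
  have h2 : ∀ s : Finset (Fin n), P (∑ k ∈ s, Pi.single k (r k)) := fun s => by
    induction s using Finset.induction_on with
    | empty => exact h0
    | insert k s hk ih => rw [Finset.sum_insert hk]; exact (h1 k _ _).1 ih
  have := h2 Finset.univ
  rwa [Finset.univ_sum_single] at this

/-- Lets `W` be moved past the monomials, so that it acts on every `e^r ⊗ N` as it does on `N`. -/
theorem commute_e0Mon {u : US n} (hu : ∀ k : Fin n, Commute (e0Unit k : US n) u) (r : Fin n → ℤ) :
    Commute (e0Mon r : US n) u := by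
  refine int_vec_induction (P := fun r => Commute (e0Mon r : US n) u) ?_ (fun k r => ?_) r
  · rw [e0Mon_zero]; exact Commute.one_left u
  · rw [e0Mon_single_add, Units.val_mul]
    refine ⟨fun h => (hu k).mul_left h, fun h => ?_⟩
    have := ((hu k).units_inv_left).mul_left h
    rwa [Units.inv_mul_cancel_left] at this

theorem wt_e0Mon (a : Fin n) (r : Fin n → ℤ) : wt a (-(r a)) (e0Mon r : US n) := by
  refine int_vec_induction (P := fun r => wt a (-(r a)) (e0Mon r : US n)) ?_ (fun k r => ?_) r
  · rw [e0Mon_zero]; simp [wt]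
  · rw [e0Mon_single_add, Units.val_mul]
    refine ⟨fun h => ?_, fun h => ?_⟩
    · convert (wt_e0 a k).mul h using 1
      simp [Pi.single_apply]; ring
    · have := (wt_inv (wt_e0 a k)).mul h
      rw [Units.inv_mul_cancel_left] at this
      convert this using 1
      simp [Pi.single_apply]

theorem kRep_e0Mon {V : Type*} [AddCommGroup V] [Module ℂ V] [LieRingModule (gl n) V]
    [LieModule ℂ (gl n) V] (r : Fin n → ℤ) : ∀ (f : KMod n V) (c : Fin n → ℂ),
    kRep n V (e0Mon r : US n) f c = f (c + fun k => (r k : ℂ)) := by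
  have e : ∀ (k : Fin n) (r : Fin n → ℤ) (c : Fin n → ℂ),
      (c + fun j => (((Pi.single k 1 + r : Fin n → ℤ) j : ℤ) : ℂ)) =
        (c + Pi.single k 1) + fun j => (r j : ℂ) := fun k r c => by
    ext j; simp [Pi.single_apply, add_assoc]
  refine int_vec_induction (P := fun r => ∀ (f : KMod n V) (c : Fin n → ℂ),
    kRep n V (e0Mon r : US n) f c = f (c + fun k => (r k : ℂ))) ?_ (fun k r => ?_) r
  · intro f c
    have e0 : (c + fun k => (((0 : Fin n → ℤ) k : ℤ) : ℂ)) = c := by ext; simp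
    rw [e0Mon_zero, Units.val_one, map_one, e0]
    rfl
  · rw [e0Mon_single_add, Units.val_mul, map_mul]
    simp only [Module.End.mul_apply, kRep_e0Unit, e]
    refine ⟨fun h f c => h f _, fun h f c => ?_⟩
    have := h f (c - Pi.single k 1)
    rwa [sub_add_cancel] at this

end Monomials

/-! ### The structure of the induced module -/

section Induced
variable {n : ℕ} {N : Type*} [AddCommGroup N] [Module ℂ N]
variable (μ : Fin n → ℂ) (π : algW n →ₐ[ℂ] Module.End ℂ N)

/-- The quotient map onto the induced module. -/
def GMod.mk : US n ⊗[ℂ] N →ₗ[US n] GMod μ π := (indRel μ π).mkQ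

/-- The vectors `e_{01}^{r_1} ⋯ e_{0n}^{r_n} ⊗ v`. -/
def GMod.mon (r : Fin n → ℤ) : N →ₗ[ℂ] GMod μ π :=
  ((GMod.mk μ π).restrictScalars ℂ).comp (TensorProduct.mk ℂ (US n) N (e0Mon r))

namespace GMod
variable {μ π}

theorem mk_tmul (u u' : US n) (v : N) : u • mk μ π (u' ⊗ₜ v) = mk μ π ((u * u') ⊗ₜ v) := by
  rw [← map_smul, TensorProduct.smul_tmul', smul_eq_mul]

theorem mon_eq (r : Fin n → ℤ) (v : N) :
    mon μ π r v = (e0Mon r : US n) • mk μ π (1 ⊗ₜ v) := by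
  rw [mk_tmul, mul_one]; rfl

theorem mk_W (w : algW n) (v : N) : (w : US n) • mk μ π (1 ⊗ₜ v) = mk μ π (1 ⊗ₜ π w v) := by
  rw [mk_tmul, mul_one, ← sub_eq_zero, ← map_sub]
  exact (Submodule.Quotient.mk_eq_zero _).2 (Submodule.subset_span (Or.inl ⟨w, v, rfl⟩))

theorem mk_h (i : Fin n) (v : N) :
    slUS (hElt i.succ) • mk μ π (1 ⊗ₜ v) = mk μ π (1 ⊗ₜ (μ i • v)) := by
  rw [mk_tmul, mul_one, ← sub_eq_zero, ← map_sub]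
  exact (Submodule.Quotient.mk_eq_zero _).2 (Submodule.subset_span (Or.inr ⟨i, v, rfl⟩))

theorem e0_mon (k : Fin n) (r : Fin n → ℤ) (v : N) :
    (e0Unit k : US n) • mon μ π r v = mon μ π (Pi.single k 1 + r) v := by
  rw [mon_eq, mon_eq, e0Mon_single_add, Units.val_mul, mul_smul]

theorem e0_inv_mon (k : Fin n) (r : Fin n → ℤ) (v : N) :
    ((e0Unit k)⁻¹ : (US n)ˣ).val • mon μ π r v = mon μ π (-Pi.single k 1 + r) v := by
  have h := e0_mon (μ := μ) (π := π) k (-Pi.single k 1 + r) v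
  rw [add_neg_cancel_left] at h
  rw [← h, ← mul_smul, Units.inv_mul, one_smul]

theorem W_mon (w : algW n) (r : Fin n → ℤ) (v : N) :
    (w : US n) • mon μ π r v = mon μ π r (π w v) := by
  have h := commute_e0Mon ((mem_algW_iff w.1).1 w.2).2 r
  rw [mon_eq, mon_eq, ← mul_smul, ← h.eq, mul_smul, mk_W]

theorem h_mon (i : Fin n) (r : Fin n → ℤ) (v : N) :
    slUS (hElt i.succ) • mon μ π r v = (μ i - r i) • mon μ π r v := by
  rw [mon_eq, ← mul_smul, wt_e0Mon i r, add_smul, mul_smul, mk_h, ← mon_eq, ← mon_eq, map_smul,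
    ← Int.cast_smul_eq_zsmul ℂ, smul_assoc, ← mon_eq, ← add_smul]
  simp [sub_eq_add_neg]

theorem root_eq (i j : Fin n) (h : i ≠ j) (hs : i.succ ≠ j.succ) :
    slUS (rootVec i.succ j.succ hs) * ((e0Unit i * (e0Unit j)⁻¹ : (US n)ˣ) : US n) =
      xElt i j h + slUS (hElt i.succ) := by
  rw [xElt, sub_add_cancel, Units.val_mul, mul_assoc]

theorem root_zero_eq (k : Fin n) :
    slUS (rootVec k.succ 0 (Fin.succ_ne_zero k)) * (e0Unit k : US n) = omegaElt k -
      ∑ j, slUS (eOrH k j) * (slUS (hElt j.succ) - 1) * (e0Unit k : US n) *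
      ((e0Unit j)⁻¹ : (US n)ˣ).val := by
  rw [omegaElt, add_sub_cancel_right]

/-- The elements of `U_S` that preserve the span form a subalgebra `T` containing `W`, the `h_i` and
the `e_{0k}^{±1}`. Solving the definitions of `x_{ij}` and `ω_k` for the root vectors shows that `T`
is all of `U_S`. -/
theorem span_mon : Submodule.span ℂ {m | ∃ r v, m = mon μ π r v} = ⊤ := by
  set p : Submodule ℂ (GMod μ π) := Submodule.span ℂ {m | ∃ r v, m = mon μ π r v}
  have hmon : ∀ r v, mon μ π r v ∈ p := fun r v => Submodule.subset_span ⟨r, v, rfl⟩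
  let ρ : US n →ₐ[ℂ] Module.End ℂ (GMod μ π) := Algebra.lsmul ℂ ℂ (GMod μ π)
  let T := (preserving p).comap ρ
  have hT : ∀ u : US n, (∀ r v, u • mon μ π r v ∈ p) → u ∈ T := fun u hu m hm => by
    change u • m ∈ p
    induction hm using Submodule.span_induction with
    | mem m hm => obtain ⟨r, v, rfl⟩ := hm; exact hu r v
    | zero => rw [smul_zero]; exact zero_mem _
    | add a b _ _ ha hb => rw [smul_add]; exact add_mem ha hb
    | smul c a _ ha => rw [smul_comm]; exact p.smul_mem c ha
  have he : ∀ k : Fin n, (e0Unit k : US n) ∈ T := fun k => hT _ fun r v => by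
    rw [e0_mon]; exact hmon _ _
  have hei : ∀ k : Fin n, ((e0Unit k)⁻¹ : (US n)ˣ).val ∈ T := fun k => hT _ fun r v => by
    rw [e0_inv_mon]; exact hmon _ _
  have hW : ∀ w : algW n, (w : US n) ∈ T := fun w => hT _ fun r v => by
    rw [W_mon]; exact hmon _ _
  have hh : ∀ i : Fin n, slUS (hElt i.succ) ∈ T := fun i => hT _ fun r v => by
    rw [h_mon]; exact p.smul_mem _ (hmon _ _)
  have hij : ∀ i j : Fin n, slUS (glv i.succ j.succ) ∈ T := fun i j => by
    by_cases h : i = j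
    · subst h; rw [← glv_h]; exact hh i
    · have hs : i.succ ≠ j.succ := by simpa using h
      -- This is `e_{ij} = (x_{ij} + h_i) e_{0j} e_{0i}⁻¹`.
      rw [← glv_root _ _ hs, ← Units.mul_inv_cancel_right (slUS (rootVec i.succ j.succ hs))
        (e0Unit i * (e0Unit j)⁻¹), root_eq i j h, mul_inv_rev, inv_inv, Units.val_mul]
      exact mul_mem (add_mem (hW ⟨_, xElt_mem i j h⟩) (hh i)) (mul_mem (he j) (hei i))
  have hk0 : ∀ k : Fin n, slUS (glv k.succ 0) ∈ T := fun k => by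
    rw [← glv_root _ _ (Fin.succ_ne_zero k), ← Units.mul_inv_cancel_right (slUS (rootVec k.succ 0 _))
      (e0Unit k), root_zero_eq]
    refine mul_mem (sub_mem (hW ⟨_, omegaElt_mem k⟩) (sum_mem fun j _ => ?_)) (hei k)
    rw [glv_eOrH]
    exact mul_mem (mul_mem (mul_mem (hij k j) (sub_mem (hh j) (one_mem _))) (he k)) (hei j)
  have hall : ∀ i j : Fin (n + 1), slUS (glv i j) ∈ T := fun i j => by
    cases i using Fin.cases with
    | zero =>
      cases j using Fin.cases with
      | zero => rw [slUS_h_zero]; exact neg_mem (sum_mem fun k _ => hij k k)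
      | succ j => rw [← e0_glv]; exact he j
    | succ i =>
      cases j using Fin.cases with
      | zero => exact hk0 i
      | succ j => exact hij i j
  have hsl : ∀ y : sl n, slUS y ∈ T := fun y => by
    let L : sl n →ₗ[ℂ] US n :=
      (toUS n).toLinearMap.comp (UniversalEnvelopingAlgebra.ι ℂ : sl n →ₗ⁅ℂ⁆ USl n).toLinearMap
    -- The multiples of the identity subtracted in the diagonal `glv i i` add up to a multiple of
    -- the trace of `y`, which is zero.
    have e : y = ∑ i, ∑ j, y.1 i j • glv i j := by
      apply Subtype.ext
      have hsum : (∑ i, ∑ j, y.1 i j • (glv i j : sl n) : sl n).1 =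
          ∑ i, ∑ j, y.1 i j • (glv i j : sl n).1 := by
        simp
      have htr : ∑ i, y.1 i i = 0 := y.2
      rw [hsum]
      simp only [glv_val, smul_sub, Finset.sum_sub_distrib, smul_ite, smul_zero,
        Finset.sum_ite_eq, Finset.mem_univ, if_true, ← Finset.sum_smul, htr, zero_smul, sub_zero]
      conv_lhs => rw [Matrix.matrix_eq_sum_single y.1]
      simp
    change L y ∈ T
    rw [e]
    simp only [map_sum, map_smul]
    exact sum_mem fun i _ => sum_mem fun j _ => T.smul_mem (hall i j) _
  have htop := subalgebra_US_eq_top T hsl hei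
  have h1 : ∀ v, mk μ π (1 ⊗ₜ v) ∈ p := fun v => by
    have := hmon 0 v
    rwa [mon_eq, e0Mon_zero, Units.val_one, one_smul] at this
  rw [eq_top_iff]
  intro m _
  obtain ⟨t, rfl⟩ : ∃ t, mk μ π t = m := Submodule.mkQ_surjective _ m
  induction t using TensorProduct.induction_on with
  | zero => rw [map_zero]; exact zero_mem _
  | add a b ha hb => rw [map_add]; exact add_mem (ha trivial) (hb trivial)
  | tmul u v =>
    have hu : u ∈ T := htop ▸ Algebra.mem_top
    have := hu _ (h1 v)
    change u • _ ∈ p at this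
    rwa [mk_tmul, mul_one] at this

end GMod

end Induced

/-! ### Freeness of the induced module -/

section Free
variable {n : ℕ} {V : Type*} [AddCommGroup V] [Module ℂ V] [LieRingModule (gl n) V]
  [LieModule ℂ (gl n) V] {ι : Type*} [Fintype ι] {b : Module.Basis ι ℂ V} {wt : ι → Fin n → ℂ}

variable (b wt) in
/-- The map `u ⊗ v ↦ u · f_v`, where `f_v` is the part of weight `μ` of the constant function `v`. -/
def toKMod (μ : Fin n → ℂ) : US n ⊗[ℂ] V →ₗ[ℂ] KMod n V :=
  TensorProduct.lift (((LinearMap.lcomp ℂ (KMod n V)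
    ((weightProj b wt μ).comp (LinearMap.pi fun _ => LinearMap.id))).comp (kRep n V).toLinearMap))

theorem toKMod_tmul (μ : Fin n → ℂ) (u : US n) (v : V) :
    toKMod b wt μ (u ⊗ₜ v) = kRep n V u (weightProj b wt μ (Function.const _ v)) := rfl

theorem toKMod_smul (μ : Fin n → ℂ) (u : US n) (t : US n ⊗[ℂ] V) :
    toKMod b wt μ (u • t) = kRep n V u (toKMod b wt μ t) := by
  induction t using TensorProduct.induction_on with
  | zero => simp
  | add a b ha hb => rw [smul_add, map_add, map_add, map_add, ha, hb]
  | tmul u' v =>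
    rw [TensorProduct.smul_tmul', toKMod_tmul, toKMod_tmul, smul_eq_mul, map_mul,
      Module.End.mul_apply]

/-- Makes the map descend to `G_μ(V^τ)`. Elements of `W` commute with the `h_k`, hence with the
projection, and act on constant functions through `τ`; the projected function has weight `μ`. -/
theorem IsWeightBasis.toKMod_indRel (hb : IsWeightBasis b wt) (μ : Fin n → ℂ) (t : US n ⊗[ℂ] V)
    (ht : t ∈ indRel μ (tauRep V)) : toKMod b wt μ t = 0 := by
  induction ht using Submodule.span_induction with
  | zero => exact map_zero _
  | add a b _ _ ha hb => rw [map_add, ha, hb, add_zero]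
  | smul u t _ ht => rw [toKMod_smul, ht, map_zero]
  | mem t ht =>
    rcases ht with ⟨w, v, rfl⟩ | ⟨i, v, rfl⟩
    · rw [map_sub, toKMod_tmul, toKMod_tmul, map_one, Module.End.one_apply, sub_eq_zero,
        hb.weightProj_comm, kRep_algW_const]
      intro k f
      have h := ((mem_algW_iff w.1).1 w.2).1 k
      rw [← Module.End.mul_apply, ← map_mul, ← h.eq, map_mul, Module.End.mul_apply]
    · rw [map_sub, toKMod_tmul, hb.kRep_h_weightProj, TensorProduct.tmul_smul, map_smul, toKMod_tmul,
        map_one, Module.End.one_apply, sub_self]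

variable (V) in
/-- The linear map `⊕_r V → G_μ(V^τ)`, `v` in degree `r` being sent to `e_{01}^{r_1} ⋯ e_{0n}^{r_n} ⊗ v`. -/
def monSum (μ : Fin n → ℂ) : ((Fin n → ℤ) →₀ V) →ₗ[ℂ] GMod μ (tauRep V) :=
  Finsupp.lsum ℂ fun r => GMod.mon μ (tauRep V) r

theorem monSum_single (μ : Fin n → ℂ) (r : Fin n → ℤ) (v : V) :
    monSum V μ (Finsupp.single r v) = GMod.mon μ (tauRep V) r v := by
  simp [monSum]

theorem monSum_surjective (μ : Fin n → ℂ) : Function.Surjective (monSum V μ) := by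
  rw [← LinearMap.range_eq_top, eq_top_iff, ← GMod.span_mon, Submodule.span_le]
  rintro _ ⟨r, v, rfl⟩
  exact ⟨Finsupp.single r v, monSum_single μ r v⟩

/-- In `KMod n V`, coordinate `p` of the image of `e^s ⊗ v` is supported at the single point `μ - wt
p - s`. Different `s` give different points, so no cancellation between monomials is possible. -/
theorem IsWeightBasis.monSum_injective (hb : IsWeightBasis b wt) (μ : Fin n → ℂ) :
    Function.Injective (monSum V μ) := by
  classical
  rw [injective_iff_map_eq_zero]
  intro f hf
  have e : monSum V μ f = GMod.mk μ (tauRep V) (f.sum fun r v => (e0Mon r : US n) ⊗ₜ v) := by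
    rw [Finsupp.sum, map_sum]; rfl
  rw [e] at hf
  have h := hb.toKMod_indRel μ _ ((Submodule.Quotient.mk_eq_zero _).1 hf)
  ext r
  refine b.ext_elem fun p => ?_
  -- At this point only the monomial with exponent `r` contributes to coordinate `p`.
  have h1 := congrArg (fun v => b.repr v p) (congrFun h (μ - wt p - fun k => (r k : ℂ)))
  have hne : ∀ s : Fin n → ℤ, wt p + (μ - wt p - (fun k => (r k : ℂ)) + fun k => (s k : ℂ)) = μ ↔
      s = r := fun s => by
    rw [show wt p + (μ - wt p - (fun k => (r k : ℂ)) + fun k => (s k : ℂ)) =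
      μ + ((fun k => (s k : ℂ)) - fun k => (r k : ℂ)) by ring, add_eq_left, sub_eq_zero]
    simp only [funext_iff, Int.cast_inj]
  simp only [Finsupp.sum, map_sum, toKMod_tmul, Finset.sum_apply, kRep_e0Mon, Finsupp.coe_finsetSum,
    repr_weightProj, hne, Function.const_apply, Finset.sum_ite_eq', Pi.zero_apply, map_zero,
    Finsupp.zero_apply] at h1
  by_cases hr : r ∈ f.support
  · rw [if_pos hr] at h1
    simpa using h1
  · simp [Finsupp.notMem_support_iff.1 hr]

theorem smul_monSum (μ : Fin n → ℂ) (u : US n) (T : (Fin n → ℤ) → Module.End ℂ V)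
    (hT : ∀ r v, u • GMod.mon μ (tauRep V) r v = GMod.mon μ (tauRep V) r (T r v))
    (f : (Fin n → ℤ) →₀ V) :
    u • monSum V μ f = monSum V μ (f.sum fun r v => Finsupp.single r (T r v)) := by
  rw [Finsupp.sum, map_sum]
  conv_lhs => rw [← Finsupp.sum_single f, Finsupp.sum, map_sum, Finset.smul_sum]
  exact Finset.sum_congr rfl fun r _ => by rw [monSum_single, monSum_single, hT]

/-- The sum of the `e^r ⊗ V` is direct, so an element preserving each summand can be analysed one
summand at a time. -/
theorem IsWeightBasis.apply_eq_zero_of_smul (hb : IsWeightBasis b wt) (μ : Fin n → ℂ) (u : US n)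
    (T : (Fin n → ℤ) → Module.End ℂ V)
    (hT : ∀ r v, u • GMod.mon μ (tauRep V) r v = GMod.mon μ (tauRep V) r (T r v))
    (f : (Fin n → ℤ) →₀ V) (hf : u • monSum V μ f = 0) (r : Fin n → ℤ) : T r (f r) = 0 := by
  rw [smul_monSum μ u T hT] at hf
  have h := DFunLike.congr_fun ((injective_iff_map_eq_zero _).1 (hb.monSum_injective μ) _ hf) r
  rw [Finsupp.sum_apply] at h
  simp only [Finsupp.single_apply, Finsupp.sum_ite_eq', Finsupp.zero_apply] at h
  by_cases hr : r ∈ f.support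
  · rwa [if_pos hr] at h
  · rw [Finsupp.notMem_support_iff.1 hr, map_zero]

/-- An element of `U_S` that preserves every subspace `e^r ⊗ V` acts injectively if and only if it acts
injectively on each of them. -/
theorem IsWeightBasis.smul_injective_iff (hb : IsWeightBasis b wt) (μ : Fin n → ℂ) (u : US n)
    (T : (Fin n → ℤ) → Module.End ℂ V)
    (hT : ∀ r v, u • GMod.mon μ (tauRep V) r v = GMod.mon μ (tauRep V) r (T r v)) :
    Function.Injective (fun m : GMod μ (tauRep V) => u • m) ↔ ∀ r, Function.Injective (T r) := by
  constructor
  · intro h r v v' hv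
    have h1 : GMod.mon μ (tauRep V) r v = GMod.mon μ (tauRep V) r v' := h (by
      change u • GMod.mon μ (tauRep V) r v = u • GMod.mon μ (tauRep V) r v'
      rw [hT, hT, hv])
    rw [← monSum_single, ← monSum_single] at h1
    exact Finsupp.single_injective r (hb.monSum_injective μ h1)
  · intro h
    refine (injective_iff_map_eq_zero (Algebra.lsmul ℂ ℂ (GMod μ (tauRep V)) u)).2 fun m hm => ?_
    obtain ⟨f, rfl⟩ := monSum_surjective μ m
    have h0 := hb.apply_eq_zero_of_smul μ u T hT f hm
    have : f = 0 := by
      ext r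
      exact h r (by rw [h0, Finsupp.zero_apply, map_zero])
    rw [this, map_zero]

end Free

/-! ### Weight spaces of the induced module -/

/-- The `h_i` commute, so their simultaneous generalized eigenspaces are independent; the weight
spaces lie inside these. -/
theorem iSupIndep_weightSpace {n : ℕ} (M : Type*) [AddCommGroup M] [Module ℂ M]
    [LieRingModule (sl n) M] [LieModule ℂ (sl n) M] :
    iSupIndep fun α : Fin n → ℂ => weightSpace M α := by
  have h := Module.End.independent_iInf_maxGenEigenspace_of_forall_mapsTo
    (fun i : Fin n => LieModule.toEnd ℂ (sl n) M (hElt i.succ)) fun i j φ => by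
      refine Module.End.mapsTo_maxGenEigenspace_of_comm ?_ φ
      have h0 : ⁅(hElt j.succ : sl n), (hElt i.succ : sl n)⁆ = 0 := by
        rw [glv_h, glv_h, glv_lie]
        by_cases hij : j = i
        · subst hij; simp
        · simp [hij, Ne.symm hij]
      rw [commute_iff_lie_eq, ← LieHom.map_lie, h0, map_zero]
  refine h.mono fun α v hv => ?_
  rw [Submodule.mem_iInf]
  exact fun i => Module.End.mem_maxGenEigenspace _ _ _ |>.2 ⟨1, by
    simpa [sub_eq_zero] using hv i⟩

section Induced
variable {n : ℕ} {V : Type*} [AddCommGroup V] [Module ℂ V] [LieRingModule (gl n) V]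
  [LieModule ℂ (gl n) V] {ι : Type*} [Fintype ι] {b : Module.Basis ι ℂ V} {wt : ι → Fin n → ℂ}

theorem isInternal_weightSpace (μ : Fin n → ℂ) :
    DirectSum.IsInternal fun α : Fin n → ℂ => weightSpace (GMod μ (tauRep V)) α := by
  classical
  rw [DirectSum.isInternal_submodule_iff_iSupIndep_and_iSup_eq_top]
  refine ⟨iSupIndep_weightSpace _, ?_⟩
  rw [eq_top_iff, ← GMod.span_mon, Submodule.span_le]
  rintro _ ⟨r, v, rfl⟩
  refine Submodule.mem_iSup_of_mem (fun i => μ i - r i) fun i => ?_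
  exact GMod.h_mon i r v

/-- The summands `e^r ⊗ V` have pairwise different weights `μ - r`, so a weight space lies in one of
them, an image of `V`. -/
theorem IsWeightBasis.finite_weightSpace (hb : IsWeightBasis b wt) (μ α : Fin n → ℂ) :
    FiniteDimensional ℂ (weightSpace (GMod μ (tauRep V)) α) := by
  have hV : FiniteDimensional ℂ V := b.finiteDimensional_of_finite
  have key : ∀ f : (Fin n → ℤ) →₀ V, monSum V μ f ∈ weightSpace (GMod μ (tauRep V)) α →
      ∀ r i, (μ i - r i - α i) • f r = 0 := fun f hf r i => by
    refine hb.apply_eq_zero_of_smul μ (slUS (hElt i.succ) - algebraMap ℂ (US n) (α i))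
      (fun r => (μ i - r i - α i) • LinearMap.id) (fun r v => ?_) f ?_ r
    · rw [sub_smul, algebraMap_smul, GMod.h_mon, ← sub_smul, ← map_smul]; rfl
    · rw [sub_smul, algebraMap_smul, sub_eq_zero]
      exact hf i
  have hle : ∃ r : Fin n → ℤ,
      weightSpace (GMod μ (tauRep V)) α ≤ LinearMap.range (GMod.mon μ (tauRep V) r) := by
    by_cases hr : ∃ r : Fin n → ℤ, ∀ i, μ i - r i - α i = 0
    · obtain ⟨r, hr⟩ := hr
      refine ⟨r, fun m hm => ?_⟩
      obtain ⟨f, rfl⟩ := monSum_surjective μ m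
      refine ⟨f r, ?_⟩
      rw [← monSum_single]
      congr 1
      ext s
      rcases eq_or_ne s r with rfl | hs
      · rw [Finsupp.single_eq_same]
      · rw [Finsupp.single_eq_of_ne hs]
        obtain ⟨i, hi⟩ := Function.ne_iff.1 hs
        refine ((smul_eq_zero.1 (key f hm s i)).resolve_left fun h => hi ?_).symm
        exact_mod_cast (show (s i : ℂ) = r i by linear_combination hr i - h)
    -- If `α ∉ μ - ℤ^n`, the weight space is zero and any `r` will do.
    · refine ⟨0, fun m hm => ?_⟩
      obtain ⟨f, rfl⟩ := monSum_surjective μ m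
      have : f = 0 := by
        ext r
        by_contra h
        exact hr ⟨r, fun i => (smul_eq_zero.1 (key f hm r i)).resolve_right h⟩
      rw [this, map_zero]
      exact zero_mem _
  obtain ⟨r, hr⟩ := hle
  exact Submodule.finiteDimensional_of_le hr

/-! ### The action of the root vectors -/

theorem tauRep_xElt (i j : Fin n) (h : i ≠ j) (v : V) :
    tauRep V ⟨xElt i j h, xElt_mem i j h⟩ v =
      ⁅(Matrix.single i j (1 : ℂ) : gl n), v⁆ - ⁅(Matrix.single i i (1 : ℂ) : gl n), v⁆ := by
  change actU n V (tau n _) v = _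
  rw [tau_xElt, map_sub, LinearMap.sub_apply, actU_glU, actU_glU]

theorem tauRep_omegaElt (k : Fin n) (v : V) :
    tauRep V ⟨omegaElt k, omegaElt_mem k⟩ v =
      ∑ j, (⁅(Matrix.single k j (1 : ℂ) : gl n), ⁅(Matrix.single j j (1 : ℂ) : gl n), v⁆⁆ -
        ⁅(Matrix.single k j (1 : ℂ) : gl n), v⁆) := by
  change actU n V (tau n _) v = _
  rw [tau_omegaElt, gammaElt, map_sum, LinearMap.sum_apply]
  simp only [map_sub, map_mul, LinearMap.sub_apply, Module.End.mul_apply, actU_glU]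

variable (V) in
/-- The operator by which `e_{ij} e_{0i} e_{0j}⁻¹` acts on `e^r ⊗ V`, where `a = μ - r`. -/
def rootOp (a : Fin n → ℂ) (i j : Fin n) : Module.End ℂ V :=
  LieModule.toEnd ℂ (gl n) V (Matrix.single i j (1 : ℂ)) -
    LieModule.toEnd ℂ (gl n) V (Matrix.single i i (1 : ℂ)) + a i • LinearMap.id

theorem rootOp_apply (a : Fin n → ℂ) (i j : Fin n) (v : V) :
    rootOp V a i j v = ⁅(Matrix.single i j (1 : ℂ) : gl n), v⁆ -
      ⁅(Matrix.single i i (1 : ℂ) : gl n), v⁆ + a i • v := rfl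

variable (V) in
/-- The operator by which `e_{k0} e_{0k}` acts on `e^r ⊗ V`, where `a = μ - r`. -/
def rootZeroOp (a : Fin n → ℂ) (k : Fin n) : Module.End ℂ V :=
  tauRep V ⟨omegaElt k, omegaElt_mem k⟩ -
    ∑ j, (a j - if j = k then 1 else 0) • rootOp V a k j

theorem root_mon (μ : Fin n → ℂ) (i j : Fin n) (h : i ≠ j) (hs : i.succ ≠ j.succ)
    (r : Fin n → ℤ) (v : V) :
    (slUS (rootVec i.succ j.succ hs) * ((e0Unit i * (e0Unit j)⁻¹ : (US n)ˣ) : US n)) •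
      GMod.mon μ (tauRep V) r v =
    GMod.mon μ (tauRep V) r (rootOp V (fun i => μ i - r i) i j v) := by
  rw [GMod.root_eq i j h, add_smul, GMod.h_mon, rootOp_apply, map_add, map_smul,
    ← tauRep_xElt i j h, ← GMod.W_mon]

/-- The vector on the left is `e_{0k} e_{0j}⁻¹ e^r ⊗ v`. For `k = j` the monomials cancel and
`e_{kk} - e_{kk}` drops out of `rootOp`, so the diagonal and off-diagonal terms of `ω_k` are covered
by the same operator. -/
theorem eOrH_mon (μ : Fin n → ℂ) (k j : Fin n) (r : Fin n → ℤ) (v : V) :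
    slUS (eOrH k j) • GMod.mon μ (tauRep V) (Pi.single k 1 + (-Pi.single j 1 + r)) v =
    GMod.mon μ (tauRep V) r (rootOp V (fun i => μ i - r i) k j v) := by
  by_cases h : k = j
  · subst h
    rw [add_neg_cancel_left, eOrH, dif_pos rfl, GMod.h_mon, rootOp_apply, sub_self, zero_add,
      map_smul]
  · have hs : k.succ ≠ j.succ := by simpa using h
    rw [← root_mon μ k j h hs, eOrH, dif_neg h, mul_smul, Units.val_mul, mul_smul, GMod.e0_inv_mon,
      GMod.e0_mon]

theorem root_zero_mon (μ : Fin n → ℂ) (k : Fin n) (r : Fin n → ℤ) (v : V) :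
    (slUS (rootVec k.succ 0 (Fin.succ_ne_zero k)) * (e0Unit k : US n)) •
      GMod.mon μ (tauRep V) r v =
    GMod.mon μ (tauRep V) r (rootZeroOp V (fun i => μ i - r i) k v) := by
  rw [GMod.root_zero_eq, sub_smul, Finset.sum_smul, rootZeroOp, LinearMap.sub_apply, map_sub,
    ← GMod.W_mon, LinearMap.sum_apply, map_sum]
  congr 1
  refine Finset.sum_congr rfl fun j _ => ?_
  -- For `j ≠ k` the factor `e_{0j}⁻¹` raises the `h_j`-weight by one and cancels the `-1`. For `j =
  -- k` the two factors cancel and the `-1` survives.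
  have hj : (slUS (hElt j.succ) - 1) •
      GMod.mon μ (tauRep V) (Pi.single k 1 + (-Pi.single j 1 + r)) v =
      (μ j - r j - if j = k then 1 else 0) •
        GMod.mon μ (tauRep V) (Pi.single k 1 + (-Pi.single j 1 + r)) v := by
    rw [sub_smul, one_smul, GMod.h_mon]
    by_cases h : j = k
    · subst h
      rw [add_neg_cancel_left, if_pos rfl]
      module
    · have e : (((Pi.single k 1 + (-Pi.single j 1 + r) : Fin n → ℤ) j : ℤ) : ℂ) = r j - 1 := by
        simp [h, neg_add_eq_sub]
      rw [e, if_neg h]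
      module
  rw [LinearMap.smul_apply, map_smul, ← eOrH_mon, mul_smul, mul_smul, mul_smul, GMod.e0_inv_mon,
    GMod.e0_mon, hj, smul_comm]

theorem IsWeightBasis.rootOp_injective_iff (hb : IsWeightBasis b wt) (i j : Fin n) (h : i ≠ j)
    (lam : ℂ) (d : ι → ℤ) (hd : ∀ p, wt p i = lam + d p) (a : Fin n → ℂ) :
    Function.Injective (rootOp V a i j) ↔ ∀ p, a i - wt p i ≠ 0 := by
  refine hb.injective_iff i lam d hd _ (fun p => a i - wt p i)
    (fun p l => if l = j then 1 else 0) fun p => ?_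
  simp only [rootOp_apply, ite_smul, one_smul, zero_smul, Finset.sum_ite_eq',
    Finset.mem_erase, Finset.mem_univ, and_true, if_pos h.symm, hb p i, sub_smul]
  abel

/-- On `b p`, the diagonal part of `ω_k - ∑ j, (a_j - δ_{jk}) (e_{kj} - e_{kk} + a_k)` is `(wt_k -
a_k) wt_k` from the term `e_{kk}`, plus `(∑ j, a_j - 1)(wt_k - a_k)` from the scalars. The sum
factors, and the rest involves only `e_{kj}` with `j ≠ k`. -/
theorem IsWeightBasis.rootZeroOp_injective_iff (hb : IsWeightBasis b wt) (k : Fin n)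
    (lam : ℂ) (d : ι → ℤ) (hd : ∀ p, wt p k = lam + d p) (a : Fin n → ℂ) :
    Function.Injective (rootZeroOp V a k) ↔
      ∀ p, (wt p k - a k) * (wt p k + ∑ j, a j - 1) ≠ 0 := by
  refine hb.injective_iff k lam d hd _ (fun p => (wt p k - a k) * (wt p k + ∑ j, a j - 1))
    (fun p j => wt p j - 1 - a j) fun p => ?_
  have e1 : ∀ j, ⁅(Matrix.single k j (1 : ℂ) : gl n), ⁅(Matrix.single j j (1 : ℂ) : gl n), b p⁆⁆ -
        ⁅(Matrix.single k j (1 : ℂ) : gl n), b p⁆ -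
      (a j - if j = k then 1 else 0) • rootOp V a k j (b p) =
      (wt p j - 1 - a j + if j = k then 1 else 0) • ⁅(Matrix.single k j (1 : ℂ) : gl n), b p⁆ +
      ((a j - if j = k then 1 else 0) * (wt p k - a k)) • b p := fun j => by
    rw [hb p j, lie_smul, rootOp_apply, hb p k]
    module
  rw [rootZeroOp, LinearMap.sub_apply, tauRep_omegaElt, LinearMap.sum_apply,
    ← Finset.sum_sub_distrib]
  simp only [LinearMap.smul_apply, e1]
  rw [Finset.sum_add_distrib, ← Finset.sum_smul, ← Finset.sum_mul, Finset.sum_sub_distrib,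
    Finset.sum_ite_eq' Finset.univ k, if_pos (Finset.mem_univ k),
    ← Finset.add_sum_erase _ _ (Finset.mem_univ k), if_pos rfl, hb p k]
  have e2 : ∀ j ∈ Finset.univ.erase k, (wt p j - 1 - a j + if j = k then 1 else 0) •
      ⁅(Matrix.single k j (1 : ℂ) : gl n), b p⁆ =
      (wt p j - 1 - a j) • ⁅(Matrix.single k j (1 : ℂ) : gl n), b p⁆ := fun j hj => by
    rw [if_neg (Finset.ne_of_mem_erase hj), add_zero]
  rw [Finset.sum_congr rfl e2]
  module

/-! ### Injectivity of the root vectors -/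

/-- A unit of `U_S` permutes the module. Root vectors may thus be replaced by products of weight
zero, which preserve every `e^r ⊗ V`. -/
theorem injective_mul_unit_smul_iff (μ : Fin n → ℂ) (y : sl n) (u : (US n)ˣ) :
    Function.Injective (fun m : GMod μ (tauRep V) => (slUS y * (u : US n)) • m) ↔
      Function.Injective fun m : GMod μ (tauRep V) => ⁅y, m⁆ := by
  have e : (fun m : GMod μ (tauRep V) => (slUS y * (u : US n)) • m) =
      (fun m : GMod μ (tauRep V) => ⁅y, m⁆) ∘ MulAction.toPerm u := by
    ext m
    exact mul_smul _ _ _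
  rw [e]
  exact Function.Injective.of_comp_iff' _ (MulAction.toPerm u).bijective

theorem injective_e0 (μ : Fin n → ℂ) (k : Fin n) (h : (0 : Fin (n + 1)) ≠ k.succ) :
    Function.Injective fun m : GMod μ (tauRep V) => ⁅(rootVec 0 k.succ h : sl n), m⁆ :=
  (MulAction.toPerm (e0Unit k) : Equiv.Perm (GMod μ (tauRep V))).injective

theorem IsWeightBasis.injective_root_iff (hb : IsWeightBasis b wt) (μ : Fin n → ℂ) (i j : Fin n)
    (h : i ≠ j) (hs : i.succ ≠ j.succ) (lam : ℂ) (d : ι → ℤ) (hd : ∀ p, wt p i = lam + d p) :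
    (Function.Injective fun m : GMod μ (tauRep V) => ⁅(rootVec i.succ j.succ hs : sl n), m⁆) ↔
      ∀ (r : Fin n → ℤ) p, μ i - r i - wt p i ≠ 0 := by
  rw [← injective_mul_unit_smul_iff μ _ (e0Unit i * (e0Unit j)⁻¹),
    hb.smul_injective_iff μ _ _ (root_mon μ i j h hs)]
  exact forall_congr' fun r => hb.rootOp_injective_iff i j h lam d hd _

theorem IsWeightBasis.injective_root_zero_iff (hb : IsWeightBasis b wt) (μ : Fin n → ℂ) (k : Fin n)
    (h : k.succ ≠ 0) (lam : ℂ) (d : ι → ℤ) (hd : ∀ p, wt p k = lam + d p) :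
    (Function.Injective fun m : GMod μ (tauRep V) => ⁅(rootVec k.succ 0 h : sl n), m⁆) ↔
      ∀ (r : Fin n → ℤ) p,
        (wt p k - (μ k - r k)) * (wt p k + ∑ j, (μ j - r j) - 1) ≠ 0 := by
  rw [← injective_mul_unit_smul_iff μ _ (e0Unit k),
    hb.smul_injective_iff μ _ _ (root_zero_mon μ k)]
  exact forall_congr' fun r => hb.rootZeroOp_injective_iff k lam d hd _

end Induced

/-! ### The cuspidality criterion -/

theorem isCuspidal_iff {n : ℕ} {V : Type*} [AddCommGroup V] [Module ℂ V] [LieRingModule (gl n) V]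
    [LieModule ℂ (gl n) V] [FiniteDimensional ℂ V] [LieModule.IsIrreducible ℂ (gl n) V]
    (lam : Fin n → ℂ) (hlam : HasHighestWeight V lam) (μ : Fin n → ℂ) :
    IsCuspidal n (GMod μ (tauRep V)) ↔
      ∀ i : Fin n, (∀ m : ℤ, μ i - lam i ≠ (m : ℂ)) ∧
        ∀ m : ℤ, (∑ j, μ j) + lam i ≠ (m : ℂ) := by
  obtain ⟨s, hs, b, d, hb⟩ := exists_weightBasis lam hlam
  -- The vectors `e_{k0}` alone already yield both families of conditions, one from each factor of
  -- the diagonal entry.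
  have hzero := fun k => hb.injective_root_zero_iff μ k (Fin.succ_ne_zero k) (lam k)
    (fun p => d p k) fun _ => rfl
  constructor
  · intro h i
    obtain ⟨v, hv0, -, hv⟩ := hlam
    obtain ⟨p, hp⟩ : ∃ p, b.repr v p ≠ 0 := by
      by_contra! h0
      exact hv0 (b.ext_elem fun p => by simpa using h0 p)
    -- A basis vector occurring in the highest weight vector has the same weight, so its offset from
    -- `lam` is zero.
    have hdp : (d p i : ℂ) = 0 := by
      have h1 := hb.repr_lie i v p
      rw [hv, map_smul, Finsupp.smul_apply, smul_eq_mul] at h1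
      simpa using mul_right_cancel₀ hp h1
    have h2 := (hzero i).1 (h.injective _ _ _)
    -- If `μ_i - λ_i = m`, then `r = m ε_i` kills the first factor. If `|μ| + λ_i = m`, then `r = (m
    -- - 1) ε_i` kills the second, whose `-1` accounts for the shift.
    refine ⟨fun m hm => h2 (Pi.single i m) p (mul_eq_zero_of_left ?_ _),
      fun m hm => h2 (Pi.single i (m - 1)) p (mul_eq_zero_of_right _ ?_)⟩
    · rw [hdp, Pi.single_eq_same, ← hm]; ring
    · rw [hdp, Finset.sum_sub_distrib, ← Int.cast_sum, Finset.sum_pi_single']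
      simp only [Finset.mem_univ, if_true, Int.cast_sub, Int.cast_one, ← hm]
      ring
  · intro h
    have h1 : ∀ (r : Fin n → ℤ) (p : s) (i : Fin n), μ i - r i - (lam i + d p i) ≠ 0 :=
      fun r p i h0 => (h i).1 (r i + d p i) (by push_cast; linear_combination h0)
    refine ⟨isInternal_weightSpace μ, hb.finite_weightSpace μ, fun i j hij => ?_⟩
    cases i using Fin.cases with
    | zero =>
      cases j using Fin.cases with
      | zero => exact absurd rfl hij
      | succ j => exact injective_e0 μ j hij
    | succ i =>
      cases j using Fin.cases with
      | zero =>
        -- A vanishing factor would make `μ_i - λ_i` or `|μ| + λ_i` an integer, since `r` and the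
        -- offset `d p` are integral.
        refine (hzero i).2 fun r p => mul_ne_zero (fun h0 => h1 r p i ?_) fun h0 =>
          (h i).2 (1 - d p i + ∑ j, r j) ?_
        · linear_combination -h0
        · rw [Finset.sum_sub_distrib] at h0
          push_cast
          linear_combination h0
      | succ j =>
        exact (hb.injective_root_iff μ i j (fun e => hij (congrArg _ e)) hij (lam i)
          (fun p => d p i) fun _ => rfl).2 fun r p => h1 r p i

end

end CuspidalGL

theorem lemma4p2 (n : ℕ) (hn : 2 ≤ n) (V : Type*) [AddCommGroup V] [Module ℂ V]
    [LieRingModule (CuspidalGL.gl n) V] [LieModule ℂ (CuspidalGL.gl n) V]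
    [FiniteDimensional ℂ V] [LieModule.IsIrreducible ℂ (CuspidalGL.gl n) V]
    (lam : Fin n → ℂ) (hlam : CuspidalGL.HasHighestWeight V lam) (μ : Fin n → ℂ) :
    CuspidalGL.IsCuspidal n (CuspidalGL.GMod μ (CuspidalGL.tauRep V)) ↔
      ∀ i : Fin n, (∀ m : ℤ, μ i - lam i ≠ (m : ℂ)) ∧
        ∀ m : ℤ, (∑ j, μ j) + lam i ≠ (m : ℂ) :=
  CuspidalGL.isCuspidal_iff lam hlam μ
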